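/- An instance of the set-union knapsack problem (SUKP) consists of a finite universe $U$ of elements with non-negative weights $\omega_j$ ($j\in U$), $n$ items with non-negative values $v_i$ and element sets $L_i\subseteq U$ ($i\in[n]=\{1,\dots,n\}$) such that $\bigcup_{i=1}^n L_i=U$, and a non-negative capacity $K$, all numbers being rational and written in binary. The task is to choose a set of items $T\subseteq[n]$ that is feasible, i.e. $\sum_{j\in\bigcup_{i\in T}L_i}\omega_j\le K$, and maximizes $\sum_{i\in T}v_i$. The instance is laminar if for all $i,j\in[n]$ the intersection $L_i\cap L_j$ is empty, or equals $L_i$, or equals $L_j$. Theorem. SUKP restricted to laminar instances admits a fully polynomial time approximation scheme (FPTAS): there are a single deterministic algorithm (a random access machine program, with running time measured by logarithmic cost) and a polynomial $p$ in two variables such that for every laminar instance $I$ and every real $\varepsilon>0$, the algorithm, given $I$ and the integer $\lceil 1/\varepsilon\rceil$, halts after time at most $p(|I|,1/\varepsilon)$, where $|I|$ is the number of bits of the encoding of $I$, and outputs a feasible set of items whose total value is at least $(1-\varepsilon)$ times the maximum total value of a feasible set of items. -/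

import Mathlib

/-! ## Random access machine with logarithmic cost

The machine has natural-number registers `reg 0, reg 1, …` and arrays `arr 0, arr 1, …` of
natural numbers; a program mentions only finitely many of them. Every elementary operation is
charged the bit length of the numbers (operands, addresses, results) that it handles, so that
running time agrees with that of Turing machines up to a polynomial. -/

namespace RAM

/-- A memory configuration: registers `reg x` and array cells `arr a i`. -/
structure State where
  reg : ℕ → ℕ
  arr : ℕ → ℕ → ℕ

/-- Arithmetic expressions; `load a e` reads the cell of the array `a` at the address `e`. -/
inductive Expr where
  | const (c : ℕ)
  | reg (x : ℕ)
  | load (a : ℕ) (e : Expr)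
  | add (e f : Expr)
  | sub (e f : Expr)
  | mul (e f : Expr)
  | div (e f : Expr)

/-- Value of an expression. Subtraction is truncated at `0`; `div` is integer division, with
value `0` when the divisor is `0`. -/
def Expr.eval (s : State) : Expr → ℕ
  | .const c => c
  | .reg x => s.reg x
  | .load a e => s.arr a (e.eval s)
  | .add e f => e.eval s + f.eval s
  | .sub e f => e.eval s - f.eval s
  | .mul e f => e.eval s * f.eval s
  | .div e f => e.eval s / f.eval s

/-- Logarithmic cost of evaluating an expression: one unit plus the bit length of the value, for
every node of the expression tree. -/
def Expr.cost (s : State) : Expr → ℕ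
  | .const c => 1 + Nat.size c
  | .reg x => 1 + Nat.size (s.reg x)
  | .load a e => e.cost s + (1 + Nat.size ((Expr.load a e).eval s))
  | .add e f => e.cost s + f.cost s + (1 + Nat.size ((Expr.add e f).eval s))
  | .sub e f => e.cost s + f.cost s + (1 + Nat.size ((Expr.sub e f).eval s))
  | .mul e f => e.cost s + f.cost s + (1 + Nat.size ((Expr.mul e f).eval s))
  | .div e f => e.cost s + f.cost s + (1 + Nat.size ((Expr.div e f).eval s))

/-- Programs. Conditions are expressions; they hold when the value is nonzero. -/
inductive Program where
  | skip
  | assign (x : ℕ) (e : Expr)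
  | store (a : ℕ) (i e : Expr)
  | seq (p q : Program)
  | ite (e : Expr) (p q : Program)
  | while (e : Expr) (p : Program)

/-- The state after `reg x := v`. -/
def State.setReg (s : State) (x v : ℕ) : State :=
  { s with reg := Function.update s.reg x v }

/-- The state after `arr a i := v`. -/
def State.setArr (s : State) (a i v : ℕ) : State :=
  { s with arr := Function.update s.arr a (Function.update (s.arr a) i v) }

/-- `Exec p s s' t`: started in the state `s`, the program `p` halts in the state `s'`, and the
total cost of the computation is `t`. -/
inductive Exec : Program → State → State → ℕ → Prop where
  | skip (s : State) : Exec .skip s s 1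
  | assign (s : State) (x : ℕ) (e : Expr) :
      Exec (.assign x e) s (s.setReg x (e.eval s)) (e.cost s + 1)
  | store (s : State) (a : ℕ) (i e : Expr) :
      Exec (.store a i e) s (s.setArr a (i.eval s) (e.eval s)) (i.cost s + e.cost s + 1)
  | seq {p q : Program} {s s' s'' : State} {t t' : ℕ} :
      Exec p s s' t → Exec q s' s'' t' → Exec (.seq p q) s s'' (t + t' + 1)
  | ite_true {e : Expr} {p q : Program} {s s' : State} {t : ℕ} :
      e.eval s ≠ 0 → Exec p s s' t → Exec (.ite e p q) s s' (e.cost s + t + 1)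
  | ite_false {e : Expr} {p q : Program} {s s' : State} {t : ℕ} :
      e.eval s = 0 → Exec q s s' t → Exec (.ite e p q) s s' (e.cost s + t + 1)
  | while_true {e : Expr} {p : Program} {s s' s'' : State} {t t' : ℕ} :
      e.eval s ≠ 0 → Exec p s s' t → Exec (.while e p) s' s'' t' →
        Exec (.while e p) s s'' (e.cost s + t + t' + 1)
  | while_false {e : Expr} {p : Program} {s : State} :
      e.eval s = 0 → Exec (.while e p) s s (e.cost s + 1)

/-- Initial state: the register `0` holds the parameter `k`, the array `0` holds the word `w`,
and every other register and cell holds `0`. -/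
def initState (k : ℕ) (w : List ℕ) : State where
  reg := fun x => if x = 0 then k else 0
  arr := fun a i => if a = 0 then w.getD i 0 else 0

end RAM

/-- The number of bits needed to write a word of natural numbers in binary, with one separator
for each number. -/
def wordSize (w : List ℕ) : ℕ := (w.map fun x => Nat.size x + 1).sum

/-! ## Maximization problems and fully polynomial time approximation schemes -/

/-- A maximization problem with nonnegative rational objective. Instances are encoded by words of
natural numbers, and `decode` reads a solution off the output array of a machine. -/
structure MaxProblem where
  Inst : Type
  encode : Inst → List ℕ
  Sol : Inst → Type
  decode : (I : Inst) → (ℕ → ℕ) → Sol I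
  Feasible : (I : Inst) → Sol I → Prop
  value : (I : Inst) → Sol I → NNRat

/-- A maximization problem admits an FPTAS: one program, given an instance `I` and the accuracy
`ε > 0` (through the integer `⌈1/ε⌉`), halts with a feasible solution in the array `1` whose value
is at least `(1 - ε)` times that of every feasible solution, in time bounded by a fixed polynomial
in the size of `I` and `1/ε`. -/
def MaxProblem.AdmitsFPTAS (P : MaxProblem) : Prop :=
  ∃ (prog : RAM.Program) (B : MvPolynomial (Fin 2) ℕ),
    ∀ (I : P.Inst) (ε : ℝ), 0 < ε →
      ∃ (s : RAM.State) (t : ℕ),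
        RAM.Exec prog (RAM.initState ⌈1 / ε⌉₊ (P.encode I)) s t ∧
        (t : ℝ) ≤ MvPolynomial.aeval ![(wordSize (P.encode I) : ℝ), 1 / ε] B ∧
        P.Feasible I (P.decode I (s.arr 1)) ∧
        ∀ T : P.Sol I, P.Feasible I T →
          (1 - ε) * (P.value I T : ℝ) ≤ (P.value I (P.decode I (s.arr 1)) : ℝ)

/-! ## The set-union knapsack problem -/

/-- An instance of the set-union knapsack problem: `n` items, a universe of `m` elements, the
element set `L i` and the value `v i` of each item, the weight `ω j` of each element, and the
capacity `K`. The element sets cover the universe. -/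
structure SUKP where
  n : ℕ
  m : ℕ
  L : Fin n → Finset (Fin m)
  v : Fin n → NNRat
  ω : Fin m → NNRat
  K : NNRat
  cover : Finset.univ.biUnion L = Finset.univ

namespace SUKP

/-- The element sets of the items form a laminar family. -/
def Laminar (I : SUKP) : Prop :=
  ∀ i j, I.L i ∩ I.L j = ∅ ∨ I.L i ∩ I.L j = I.L i ∨ I.L i ∩ I.L j = I.L j

/-- A set of items is feasible if the union of its element sets weighs at most `K`. -/
def Feasible (I : SUKP) (T : Finset (Fin I.n)) : Prop :=
  ∑ j ∈ T.biUnion I.L, I.ω j ≤ I.K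

/-- The total value of a set of items. -/
def value (I : SUKP) (T : Finset (Fin I.n)) : NNRat := ∑ i ∈ T, I.v i

/-- The encoding of an instance: `n`, `m`, and the capacity, then the numerators and the
denominators of the values and of the weights, then the item-element incidence matrix, row by
row. -/
def encode (I : SUKP) : List ℕ :=
  [I.n, I.m, I.K.num, I.K.den] ++
    List.ofFn (fun i => (I.v i).num) ++ List.ofFn (fun i => (I.v i).den) ++
    List.ofFn (fun j => (I.ω j).num) ++ List.ofFn (fun j => (I.ω j).den) ++
    List.ofFn (fun p : Fin (I.n * I.m) => if p.modNat ∈ I.L p.divNat then 1 else 0)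

end SUKP

/-- The set-union knapsack problem restricted to laminar instances. A machine outputs a set of
items through the nonzero cells of its output array. -/
def laminarSUKP : MaxProblem where
  Inst := {I : SUKP // I.Laminar}
  encode I := I.1.encode
  Sol I := Finset (Fin I.1.n)
  decode _ out := Finset.univ.filter fun i => out i ≠ 0
  Feasible I T := I.1.Feasible T
  value I T := I.1.value T

/-! ### Memory after a write -/

namespace RAM

/-! The scheme rounds the values and then solves the rounded problem exactly, by dynamic programming
over values along the forest formed by the element sets.

Weights and capacity are scaled to integers, and `C` is the scaled capacity plus one. The table of a
set `D` of items holds at `p` the complementary weight `C - wt S` of some `S ⊆ D` of value `p`.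
Feasible sets have positive complementary weight, so `0`, the initial content of the memory, means
"no entry". A table has to be sound (nonzero entries come from actual sets) and complete (every
feasible subset of `D` is dominated in value and weight by an entry). Two facts give the recursion.
If the element sets of `D` are disjoint from those of `E`, weights add and the tables combine by
convolution (`Complete.add`). If all element sets of `D` lie inside that of `i`, a solution
containing `i` can be enlarged to all of `insert i D` at no cost, so one further entry accounts for
`i` (`Complete.insert`). Items are processed by increasing cardinality; by laminarity an earlier
root whose set meets that of `i` is contained in it (`processCmd_spec`). Finally all roots are
merged.

Let `bn / bd` be the largest value of an item that is feasible alone, and `k = ⌈1/ε⌉`. Values are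
multiplied by `k * n * bd / bn` and rounded down. An item of a feasible set then has value at most
`k * n`, so tables of width `k * n² + 1` suffice (`Best.bdd`). The optimum is at least `k * n`,
whereas rounding loses at most `n ≤ ε * (k * n)` (`approx`).

For the running time, the program is written in a language of bounded loops whose iteration numbers
depend only on the input, and in which every product has a factor read from the input. Hence each
operation lengthens the numbers by an amount controlled by the input alone: bit lengths grow
additively and cannot double repeatedly. `Cmd.exec` turns this into a polynomial bound. Solutions
are stored as bit masks, so a table entry is a pair of numbers. -/

@[simp] lemma State.setReg_reg (s : State) (x v y : ℕ) :
    (s.setReg x v).reg y = if y = x then v else s.reg y := by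
  simp [State.setReg, Function.update_apply]

@[simp] lemma State.setReg_arr (s : State) (x v : ℕ) : (s.setReg x v).arr = s.arr := rfl

@[simp] lemma State.setArr_reg (s : State) (a i v : ℕ) : (s.setArr a i v).reg = s.reg := rfl

@[simp] lemma State.setArr_arr (s : State) (a i v b : ℕ) :
    (s.setArr a i v).arr b = if b = a then Function.update (s.arr a) i v else s.arr b := by
  by_cases h : b = a
  · subst h; simp [State.setArr]
  · simp [State.setArr, h]

/-! ### Structured programs with bounded loops -/

/-- Programs whose only loops are of the form `for x < e`. -/
inductive Cmd where
  | skip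
  | assign (x : ℕ) (e : Expr)
  | store (a : ℕ) (i e : Expr)
  | seq (c d : Cmd)
  | ite (e : Expr) (c d : Cmd)
  | loop (x : ℕ) (e : Expr) (c : Cmd)

/-- Translation to programs. -/
def Cmd.compile : Cmd → Program
  | .skip => .skip
  | .assign x e => .assign x e
  | .store a i e => .store a i e
  | .seq c d => .seq c.compile d.compile
  | .ite e c d => .ite e c.compile d.compile
  | .loop x e c => .seq (.assign x (.const 0))
      (.while (.sub e (.reg x)) (.seq c.compile (.assign x (.add (.reg x) (.const 1)))))

/-- The state in which a command terminates. -/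
def Cmd.den : Cmd → State → State
  | .skip, s => s
  | .assign x e, s => s.setReg x (e.eval s)
  | .store a i e, s => s.setArr a (i.eval s) (e.eval s)
  | .seq c d, s => d.den (c.den s)
  | .ite e c d, s => if e.eval s = 0 then d.den s else c.den s
  | .loop x e c, s =>
      (fun s' => (c.den s').setReg x ((c.den s').reg x + 1))^[e.eval s] (s.setReg x 0)

/-- The registers that a command may change. -/
def Cmd.regs : Cmd → List ℕ
  | .skip => []
  | .assign x _ => [x]
  | .store _ _ _ => []
  | .seq c d => c.regs ++ d.regs
  | .ite _ c d => c.regs ++ d.regs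
  | .loop x _ c => x :: c.regs

/-- The arrays that a command may change. -/
def Cmd.arrs : Cmd → List ℕ
  | .skip => []
  | .assign _ _ => []
  | .store a _ _ => [a]
  | .seq c d => c.arrs ++ d.arrs
  | .ite _ c d => c.arrs ++ d.arrs
  | .loop _ _ c => c.arrs

/-- Two states that agree outside the given registers and arrays. -/
def Frame (R A : List ℕ) (s s' : State) : Prop :=
  (∀ x, x ∉ R → s'.reg x = s.reg x) ∧ (∀ a, a ∉ A → s'.arr a = s.arr a)

lemma Frame.trans {R A : List ℕ} {s s' s'' : State} (h : Frame R A s s') (h' : Frame R A s' s'') :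
    Frame R A s s'' :=
  ⟨fun x hx => (h'.1 x hx).trans (h.1 x hx), fun a ha => (h'.2 a ha).trans (h.2 a ha)⟩

lemma Frame.mono {R A R' A' : List ℕ} {s s' : State} (h : Frame R A s s') (hR : R ⊆ R')
    (hA : A ⊆ A') : Frame R' A' s s' :=
  ⟨fun x hx => h.1 x fun h => hx (hR h), fun a ha => h.2 a fun h => ha (hA h)⟩

lemma Frame.refl (R A : List ℕ) (s : State) : Frame R A s s := ⟨fun _ _ => rfl, fun _ _ => rfl⟩

lemma Frame.setReg {R A : List ℕ} {x : ℕ} (hx : x ∈ R) (s : State) (v : ℕ) :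
    Frame R A s (s.setReg x v) := by
  refine ⟨fun y hy => ?_, fun _ _ => rfl⟩
  have : y ≠ x := fun h => hy (h ▸ hx)
  simp [this]

/-- The lists of changed registers and arrays are syntactic, so noninterference of a concrete
command with a given register or array is settled by `decide`. -/
theorem Cmd.den_frame (c : Cmd) (s : State) : Frame c.regs c.arrs s (c.den s) := by
  induction c generalizing s with
  | skip => exact Frame.refl _ _ _
  | assign x e => exact Frame.setReg (by simp [Cmd.regs]) _ _
  | store a i e =>
    refine ⟨fun _ _ => rfl, fun b hb => ?_⟩
    have : b ≠ a := by simpa [Cmd.arrs] using hb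
    simp [Cmd.den, this]
  | seq c d hc hd =>
    exact ((hc s).mono (by simp [Cmd.regs]) (by simp [Cmd.arrs])).trans
      ((hd _).mono (by simp [Cmd.regs]) (by simp [Cmd.arrs]))
  | ite e c d hc hd =>
    unfold Cmd.den
    split
    · exact (hd s).mono (by simp [Cmd.regs]) (by simp [Cmd.arrs])
    · exact (hc s).mono (by simp [Cmd.regs]) (by simp [Cmd.arrs])
  | loop x e c hc =>
    unfold Cmd.den
    have h0 : Frame (Cmd.loop x e c).regs (Cmd.loop x e c).arrs s (s.setReg x 0) :=
      Frame.setReg (by simp [Cmd.regs]) _ _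
    have key : ∀ k s', Frame (Cmd.loop x e c).regs (Cmd.loop x e c).arrs s'
        ((fun s' => (c.den s').setReg x ((c.den s').reg x + 1))^[k] s') := by
      intro k
      induction k with
      | zero => intro s'; exact Frame.refl _ _ _
      | succ k ih =>
        intro s'
        rw [Function.iterate_succ_apply]
        refine Frame.trans ?_ (ih _)
        exact ((hc s').mono (by simp [Cmd.regs]) (by simp [Cmd.arrs])).trans
          (Frame.setReg (by simp [Cmd.regs]) _ _)
    exact h0.trans (key _ _)

lemma Cmd.den_reg (c : Cmd) (s : State) {x : ℕ} (h : x ∉ c.regs) : (c.den s).reg x = s.reg x :=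
  (c.den_frame s).1 x h

lemma Cmd.den_arr (c : Cmd) (s : State) {a : ℕ} (h : a ∉ c.arrs) : (c.den s).arr a = s.arr a :=
  (c.den_frame s).2 a h

/-- Invariant rule for bounded loops. -/
theorem Cmd.loop_inv {x : ℕ} {e : Expr} {c : Cmd} {s : State} (I : ℕ → State → Prop)
    (hx : x ∉ c.regs) {b : ℕ} (hb : e.eval s = b) (h0 : I 0 (s.setReg x 0))
    (hs : ∀ i s', i < b → Frame (x :: c.regs) c.arrs s s' → s'.reg x = i → I i s' →
      I (i + 1) ((c.den s').setReg x (i + 1))) :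
    I b ((Cmd.loop x e c).den s) := by
  -- The frame and the value of the counter are carried along with `I`, so that users of the rule
  -- get them for free.
  have key : ∀ k, k ≤ b →
      Frame (x :: c.regs) c.arrs s
        ((fun s' => (c.den s').setReg x ((c.den s').reg x + 1))^[k] (s.setReg x 0)) ∧
      ((fun s' => (c.den s').setReg x ((c.den s').reg x + 1))^[k] (s.setReg x 0)).reg x = k ∧
      I k ((fun s' => (c.den s').setReg x ((c.den s').reg x + 1))^[k] (s.setReg x 0)) := by
    intro k
    induction k with
    | zero => exact fun _ => ⟨Frame.setReg (by simp) _ _, by simp, h0⟩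
    | succ k ih =>
      intro hk
      obtain ⟨hf, hr, hI⟩ := ih (by omega)
      rw [Function.iterate_succ_apply']
      set s' := (fun s' => (c.den s').setReg x ((c.den s').reg x + 1))^[k] (s.setReg x 0)
      have hr' : (c.den s').reg x = k := by rw [c.den_reg _ hx, hr]
      refine ⟨hf.trans ?_, ?_, ?_⟩
      · exact ((c.den_frame s').mono (by simp) (by simp)).trans (Frame.setReg (by simp) _ _)
      · simp [hr']
      · simp only [hr']
        exact hs k s' (by omega) hf hr hI
  have := (key b le_rfl).2.2
  simpa only [Cmd.den, hb] using this

/-! ### Running time -/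

/-- Size of an expression, counting the bits of its constants. -/
def Expr.len : Expr → ℕ
  | .const c => Nat.size c + 1
  | .reg _ => 1
  | .load _ e => e.len + 1
  | .add e f => e.len + f.len + 1
  | .sub e f => e.len + f.len + 1
  | .mul e f => e.len + f.len + 1
  | .div e f => e.len + f.len + 1

/-- Expressions that read a number of the input. -/
def Expr.isInput : Expr → Bool
  | .reg x => x == 0
  | .load a _ => a == 0
  | _ => false

/-- Every product has a factor that is a number of the input. -/
def Expr.ok : Expr → Bool
  | .const _ => true
  | .reg _ => true
  | .load _ e => e.ok
  | .add e f => e.ok && f.ok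
  | .sub e f => e.ok && f.ok
  | .mul e f => e.ok && f.ok && (e.isInput || f.isInput)
  | .div e f => e.ok && f.ok

/-- The expression depends only on the input. -/
def Expr.isStatic : Expr → Bool
  | .const _ => true
  | .reg x => x == 0
  | .load a e => a == 0 && e.isStatic
  | .add e f => e.isStatic && f.isStatic
  | .sub e f => e.isStatic && f.isStatic
  | .mul e f => e.isStatic && f.isStatic
  | .div e f => e.isStatic && f.isStatic

/-- The input is never overwritten, the loop variables are not changed in the loops, and the
numbers of iterations depend only on the input. -/
def Cmd.ok : Cmd → Bool
  | .skip => true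
  | .assign x e => x != 0 && e.ok
  | .store a i e => a != 0 && i.ok && e.ok
  | .seq c d => c.ok && d.ok
  | .ite e c d => e.ok && c.ok && d.ok
  | .loop x e c => x != 0 && e.isStatic && e.ok && c.ok && !(c.regs.contains x)

/-- The numbers of iterations of the loops are at most `N` on the given input. -/
def Cmd.LoopsLE (s₀ : State) (N : ℕ) : Cmd → Prop
  | .skip => True
  | .assign _ _ => True
  | .store _ _ _ => True
  | .seq c d => c.LoopsLE s₀ N ∧ d.LoopsLE s₀ N
  | .ite _ c d => c.LoopsLE s₀ N ∧ d.LoopsLE s₀ N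
  | .loop _ e c => e.eval s₀ ≤ N ∧ c.LoopsLE s₀ N

open Polynomial in
/-- Growth of the bit lengths of the numbers in the memory, in terms of a bound for the loops. -/
noncomputable def Cmd.grow : Cmd → ℕ[X]
  | .skip => 0
  | .assign _ e => C e.len
  | .store _ i e => C (i.len + e.len)
  | .seq c d => c.grow + d.grow
  | .ite e c d => C e.len + c.grow + d.grow
  | .loop _ e c => X * (c.grow + 3) + C (e.len + 2)

open Polynomial in
/-- Number of operations, in terms of a bound for the loops. -/
noncomputable def Cmd.ops : Cmd → ℕ[X]
  | .skip => 1
  | .assign _ e => C (e.len + 1)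
  | .store _ i e => C (i.len + e.len + 1)
  | .seq c d => c.ops + d.ops + 1
  | .ite e c d => C (e.len + 1) + c.ops + d.ops
  | .loop _ e c => X * (c.ops + C (e.len + 10)) + C (e.len + 10)

/-- All numbers in the memory have at most `b` bits. -/
def Bits (b : ℕ) (s : State) : Prop :=
  (∀ x, (s.reg x).size ≤ b) ∧ ∀ a i, (s.arr a i).size ≤ b

lemma Bits.mono {b b' : ℕ} {s : State} (h : Bits b s) (hb : b ≤ b') : Bits b' s :=
  ⟨fun x => (h.1 x).trans hb, fun a i => (h.2 a i).trans hb⟩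

lemma Bits.setReg {b x v : ℕ} {s : State} (h : Bits b s) (hv : v.size ≤ b) :
    Bits b (s.setReg x v) := by
  refine ⟨fun y => ?_, h.2⟩
  rw [State.setReg_reg]
  split
  · exact hv
  · exact h.1 y

lemma Bits.setArr {b a i v : ℕ} {s : State} (h : Bits b s) (hv : v.size ≤ b) :
    Bits b (s.setArr a i v) := by
  refine ⟨h.1, fun c j => ?_⟩
  rw [State.setArr_arr]
  split
  · rw [Function.update_apply]
    split
    · exact hv
    · exact h.2 _ _
  · exact h.2 _ _

/-! ### Bit lengths and costs of expressions -/

lemma size_add_le (x y : ℕ) : (x + y).size ≤ max x.size y.size + 1 := by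
  rw [Nat.size_le, pow_succ]
  have hx : x < 2 ^ max x.size y.size := Nat.size_le.1 (le_max_left _ _)
  have hy : y < 2 ^ max x.size y.size := Nat.size_le.1 (le_max_right _ _)
  omega

lemma size_mul_le (x y : ℕ) : (x * y).size ≤ x.size + y.size := by
  rw [Nat.size_le, pow_add]
  exact Nat.mul_lt_mul'' (Nat.lt_size_self x) (Nat.lt_size_self y)

lemma Expr.isInput_size {e : Expr} {s : State} {u : ℕ} (he : e.isInput = true)
    (h0 : (s.reg 0).size ≤ u) (hw : ∀ i, (s.arr 0 i).size ≤ u) : (e.eval s).size ≤ u := by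
  cases e <;> simp_all [Expr.isInput, Expr.eval]

/-- In a product one factor has at most `u` bits, so every node of the expression adds at most `u +
1` bits to the bound `b` for the memory; without `ok`, nested products would multiply `b`. -/
lemma Expr.size_eval {e : Expr} {s : State} {u b : ℕ} (he : e.ok = true)
    (h0 : (s.reg 0).size ≤ u) (hw : ∀ i, (s.arr 0 i).size ≤ u) (hs : Bits b s) :
    (e.eval s).size ≤ b + e.len * (u + 1) := by
  induction e with
  | const c => simp only [Expr.eval, Expr.len]; nlinarith
  | reg x => exact (hs.1 x).trans (by omega)
  | load a e _ => exact (hs.2 a _).trans (by omega)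
  | add e f ihe ihf =>
    simp only [Expr.ok, Bool.and_eq_true] at he
    have h1 := ihe he.1
    have h2 := ihf he.2
    have h3 := size_add_le (e.eval s) (f.eval s)
    simp only [Expr.eval, Expr.len, add_mul]
    rcases max_cases (e.eval s).size (f.eval s).size with h | h <;> rw [h.1] at h3 <;> nlinarith
  | sub e f ihe _ =>
    simp only [Expr.ok, Bool.and_eq_true] at he
    have h1 := ihe he.1
    have h3 := Nat.size_le_size (Nat.sub_le (e.eval s) (f.eval s))
    simp only [Expr.eval, Expr.len, add_mul]
    nlinarith
  | div e f ihe _ =>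
    simp only [Expr.ok, Bool.and_eq_true] at he
    have h1 := ihe he.1
    have h3 := Nat.size_le_size (Nat.div_le_self (e.eval s) (f.eval s))
    simp only [Expr.eval, Expr.len, add_mul]
    nlinarith
  | mul e f ihe ihf =>
    simp only [Expr.ok, Bool.and_eq_true, Bool.or_eq_true] at he
    have h1 := ihe he.1.1
    have h2 := ihf he.1.2
    have h3 := size_mul_le (e.eval s) (f.eval s)
    simp only [Expr.eval, Expr.len, add_mul]
    rcases he.2 with h | h
    · have := Expr.isInput_size h h0 hw
      nlinarith
    · have := Expr.isInput_size h h0 hw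
      nlinarith

lemma Expr.cost_le {e : Expr} {s : State} {u b : ℕ} (he : e.ok = true)
    (h0 : (s.reg 0).size ≤ u) (hw : ∀ i, (s.arr 0 i).size ≤ u) (hs : Bits b s) :
    e.cost s ≤ e.len * (b + e.len * (u + 1) + 1) := by
  -- The induction step common to all binary nodes: `a`, `c` are the lengths of the subexpressions
  -- and `z` is the bit length of the result.
  have bin : ∀ (x y z a c : ℕ), x ≤ a * (b + a * (u + 1) + 1) → y ≤ c * (b + c * (u + 1) + 1) →
      z ≤ b + (a + c + 1) * (u + 1) →
      x + y + (1 + z) ≤ (a + c + 1) * (b + (a + c + 1) * (u + 1) + 1) := by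
    intro x y z a c hx hy hz
    have h1 : a * (b + a * (u + 1) + 1) ≤ a * (b + (a + c + 1) * (u + 1) + 1) := by
      gcongr; omega
    have h2 : c * (b + c * (u + 1) + 1) ≤ c * (b + (a + c + 1) * (u + 1) + 1) := by
      gcongr; omega
    nlinarith
  induction e with
  | const c =>
    have := Expr.size_eval (e := .const c) he h0 hw hs
    simp only [Expr.eval, Expr.len, Expr.cost] at *
    nlinarith
  | reg x =>
    have := hs.1 x
    simp only [Expr.len, Expr.cost]
    omega
  | load a e ih =>
    have h1 := ih he
    have h2 := hs.2 a (e.eval s)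
    have := bin (e.cost s) 0 ((Expr.load a e).eval s).size e.len 0 h1 (by simp)
      (h2.trans (by omega))
    simpa [Expr.cost, Expr.len] using this
  | add e f ihe ihf | sub e f ihe ihf | div e f ihe ihf =>
    have h3 := Expr.size_eval he h0 hw hs
    simp only [Expr.ok, Bool.and_eq_true] at he
    exact bin _ _ _ _ _ (ihe he.1) (ihf he.2) h3
  | mul e f ihe ihf =>
    have h3 := Expr.size_eval he h0 hw hs
    simp only [Expr.ok, Bool.and_eq_true] at he
    exact bin _ _ _ _ _ (ihe he.1.1) (ihf he.1.2) h3

lemma Expr.isStatic_eval {e : Expr} {s s' : State} (he : e.isStatic = true)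
    (h0 : s.reg 0 = s'.reg 0) (hw : s.arr 0 = s'.arr 0) : e.eval s = e.eval s' := by
  induction e <;> simp_all [Expr.isStatic, Expr.eval]

/-- With `Expr.isStatic_eval` this makes loop bounds computable from the initial state at any time.
-/
lemma Cmd.ok_input {c : Cmd} (hc : c.ok = true) : 0 ∉ c.regs ∧ 0 ∉ c.arrs := by
  induction c <;> simp_all [Cmd.ok, Cmd.regs, Cmd.arrs] <;> grind

/-! ### Running time of loops and programs -/

lemma while_arith {b r g l u o c1 t1 t3 c2 : ℕ}
    (h2 : c1 ≤ (l + 1 + 1) * (b + (l + 1 + 1) * (u + 1) + 1))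
    (ht1 : t1 ≤ o * (b + g * (u + 1) + 1))
    (ht3 : t3 ≤ (r * (o + (l + 10)) + (l + 3)) *
      (b + (g + 3) * (u + 1) + (r * (g + 3) + (l + 2)) * (u + 1) + 1))
    (hac : c2 ≤ 2 * (b + (g + 3) * (u + 1)) + 5) :
    c1 + (t1 + (c2 + 1) + 1) + t3 + 1 ≤ ((r + 1) * (o + (l + 10)) + (l + 3)) *
      (b + ((r + 1) * (g + 3) + (l + 2)) * (u + 1) + 1) := by
  -- Every memory bound occurring below is at most `Z`. One iteration then costs `l + 2` (test), `o`
  -- (body), `2` (increment) and `6` (constants) times `Z`, which is the origin of `o + (l + 10)`.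
  obtain ⟨Z, hZ⟩ : ∃ Z, Z = b + ((r + 1) * (g + 3) + (l + 2)) * (u + 1) + 1 := ⟨_, rfl⟩
  have z1 : b + (l + 1 + 1) * (u + 1) + 1 ≤ Z := by
    have := Nat.mul_le_mul_right (u + 1)
      (show l + 1 + 1 ≤ (r + 1) * (g + 3) + (l + 2) from Nat.le_add_left _ _)
    omega
  have w : g + 3 ≤ (r + 1) * (g + 3) + (l + 2) :=
    (Nat.le_mul_of_pos_left _ (Nat.succ_pos r)).trans (Nat.le_add_right _ _)
  have z2 : b + g * (u + 1) + 1 ≤ Z := by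
    rw [hZ]; gcongr; exact (Nat.le_add_right _ _).trans w
  have z3 : b + (g + 3) * (u + 1) + (r * (g + 3) + (l + 2)) * (u + 1) + 1 ≤ Z := by
    rw [hZ]; apply le_of_eq; ring
  have z4 : b + (g + 3) * (u + 1) + 1 ≤ Z := by rw [hZ]; gcongr
  have y1 := h2.trans (Nat.mul_le_mul_left _ z1)
  have y2 := ht1.trans (Nat.mul_le_mul_left _ z2)
  have y3 := ht3.trans (Nat.mul_le_mul_left _ z3)
  have y4 : c2 ≤ 2 * Z + 3 := hac.trans (by omega)
  have z5 : 1 ≤ Z := by omega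
  rw [← hZ]
  clear hZ z1 z2 z3 z4 h2 ht1 ht3 hac w
  nlinarith

/-- Running time of the `while` loop that implements a bounded loop. -/
lemma Cmd.exec_while {s₀ : State} {u g o : ℕ} (h0 : (s₀.reg 0).size ≤ u)
    (hw : ∀ i, (s₀.arr 0 i).size ≤ u) {x : ℕ} {e : Expr} {c : Cmd} (hx0 : x ≠ 0)
    (hst : e.isStatic = true) (heok : e.ok = true) (hcok : c.ok = true) (hxc : x ∉ c.regs)
    (ihc : ∀ (s : State) (b : ℕ), s.reg 0 = s₀.reg 0 → s.arr 0 = s₀.arr 0 → Bits b s →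
      Bits (b + g * (u + 1)) (c.den s) ∧
      ∃ t, Exec c.compile s (c.den s) t ∧ t ≤ o * (b + g * (u + 1) + 1))
    (r : ℕ) (s : State) (b : ℕ) (hs0 : s.reg 0 = s₀.reg 0) (hsw : s.arr 0 = s₀.arr 0)
    (hb : Bits b s) (hr : e.eval s₀ - s.reg x = r) :
    Bits (b + r * (g + 3) * (u + 1))
      ((fun s' => (c.den s').setReg x ((c.den s').reg x + 1))^[r] s) ∧
    ∃ t, Exec (.while (.sub e (.reg x)) (.seq c.compile (.assign x (.add (.reg x) (.const 1)))))
      s ((fun s' => (c.den s').setReg x ((c.den s').reg x + 1))^[r] s) t ∧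
      t ≤ (r * (o + (e.len + 10)) + (e.len + 3)) *
        (b + (r * (g + 3) + (e.len + 2)) * (u + 1) + 1) := by
  have H0 : ∀ s : State, s.reg 0 = s₀.reg 0 → (s.reg 0).size ≤ u := fun s h => h ▸ h0
  have Hw : ∀ s : State, s.arr 0 = s₀.arr 0 → ∀ i, (s.arr 0 i).size ≤ u := fun s h => h ▸ hw
  set step : State → State := fun s' => (c.den s').setReg x ((c.den s').reg x + 1) with hstep
  have subok : (Expr.sub e (.reg x)).ok = true := by simp [Expr.ok, heok]
  induction r generalizing s b with
  | zero =>
    refine ⟨by simpa using hb, _, Exec.while_false ?_, ?_⟩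
    · simp only [Expr.eval]
      rw [Expr.isStatic_eval hst hs0 hsw, hr]
    · have := Expr.cost_le subok (H0 s hs0) (Hw s hsw) hb
      simp only [Expr.len] at this
      simp only [zero_mul, zero_add]
      nlinarith
  | succ r ih =>
    obtain ⟨hb1, t1, he1, ht1⟩ := ihc s b hs0 hsw hb
    have hok := ok_input hcok
    have hc0 : (c.den s).reg 0 = s₀.reg 0 := (c.den_reg s hok.1).trans hs0
    have hcw : (c.den s).arr 0 = s₀.arr 0 := (c.den_arr s hok.2).trans hsw
    have h1 := size_add_le ((c.den s).reg x) 1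
    have h1' := hb1.1 x
    have h2 := Expr.cost_le subok (H0 s hs0) (Hw s hsw) hb
    have hsz : (1 : ℕ).size = 1 := by simp
    have hxs : ((c.den s).reg x + 1).size ≤ b + (g + 3) * (u + 1) := by
      rw [hsz] at h1
      rcases max_cases ((c.den s).reg x).size 1 with h | h <;> rw [h.1] at h1 <;> nlinarith
    have hb2 : Bits (b + (g + 3) * (u + 1)) (step s) :=
      (hb1.mono (by nlinarith)).setReg hxs
    obtain ⟨hb3, t3, he3, ht3⟩ := ih (step s) (b + (g + 3) * (u + 1))
      (by simp [hstep, Ne.symm hx0, hc0]) (by simp [hstep, hcw]) hb2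
      (by simp [hstep, c.den_reg s hxc]; omega)
    rw [Function.iterate_succ_apply]
    refine ⟨hb3.mono (by nlinarith), _, Exec.while_true ?_ (Exec.seq he1 (Exec.assign _ x _))
      he3, ?_⟩
    · simp only [Expr.eval]
      rw [Expr.isStatic_eval hst hs0 hsw, hr]
      omega
    · have hac : (Expr.add (.reg x) (.const 1)).cost (c.den s) ≤
          2 * (b + (g + 3) * (u + 1)) + 5 := by
        simp only [Expr.cost, Expr.eval, hsz]
        nlinarith
      simp only [Expr.len] at h2
      exact while_arith h2 ht1 ht3 hac

/-- Running time of structured programs: it is enough to bound the numbers of iterations of the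
loops, and the lengths of the numbers in the input. -/
theorem Cmd.exec {s₀ : State} {N u : ℕ} (h0 : (s₀.reg 0).size ≤ u)
    (hw : ∀ i, (s₀.arr 0 i).size ≤ u) (c : Cmd) (hc : c.ok = true) (hN : c.LoopsLE s₀ N)
    (s : State) (b : ℕ) (hs0 : s.reg 0 = s₀.reg 0) (hsw : s.arr 0 = s₀.arr 0) (hb : Bits b s) :
    Bits (b + c.grow.eval N * (u + 1)) (c.den s) ∧
    ∃ t, Exec c.compile s (c.den s) t ∧
      t ≤ c.ops.eval N * (b + c.grow.eval N * (u + 1) + 1) := by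
  have H0 : ∀ s : State, s.reg 0 = s₀.reg 0 → (s.reg 0).size ≤ u := fun s h => h ▸ h0
  have Hw : ∀ s : State, s.arr 0 = s₀.arr 0 → ∀ i, (s.arr 0 i).size ≤ u := fun s h => h ▸ hw
  induction c generalizing s b with
  | skip =>
    refine ⟨by simpa [Cmd.den, Cmd.grow] using hb, 1, Exec.skip s, ?_⟩
    simp [Cmd.ops]
  | assign x e =>
    simp only [Cmd.ok, Bool.and_eq_true] at hc
    have h1 := Expr.size_eval hc.2 (H0 s hs0) (Hw s hsw) hb
    have h2 := Expr.cost_le hc.2 (H0 s hs0) (Hw s hsw) hb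
    simp only [Cmd.grow, Cmd.ops, Polynomial.eval_C]
    refine ⟨(hb.mono (by omega)).setReg h1, _, Exec.assign s x e, ?_⟩
    nlinarith
  | store a i e =>
    simp only [Cmd.ok, Bool.and_eq_true] at hc
    have h1 := Expr.size_eval hc.2 (H0 s hs0) (Hw s hsw) hb
    have h2 := Expr.cost_le hc.2 (H0 s hs0) (Hw s hsw) hb
    have h3 := Expr.cost_le hc.1.2 (H0 s hs0) (Hw s hsw) hb
    simp only [Cmd.grow, Cmd.ops, Polynomial.eval_C]
    refine ⟨(hb.mono (by omega)).setArr (h1.trans (by nlinarith)), _, Exec.store s a i e, ?_⟩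
    have h4 : e.len * (b + e.len * (u + 1) + 1) ≤ e.len * (b + (i.len + e.len) * (u + 1) + 1) := by
      gcongr; omega
    have h5 : i.len * (b + i.len * (u + 1) + 1) ≤ i.len * (b + (i.len + e.len) * (u + 1) + 1) := by
      gcongr; omega
    nlinarith
  | seq c d ihc ihd =>
    simp only [Cmd.ok, Bool.and_eq_true] at hc
    obtain ⟨hb1, t1, he1, ht1⟩ := ihc hc.1 hN.1 s b hs0 hsw hb
    obtain ⟨hb2, t2, he2, ht2⟩ := ihd hc.2 hN.2 (c.den s) _
      ((c.den_reg s (ok_input hc.1).1).trans hs0) ((c.den_arr s (ok_input hc.1).2).trans hsw) hb1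
    simp only [Cmd.grow, Cmd.ops, Polynomial.eval_add, Polynomial.eval_one]
    refine ⟨hb2.mono (by nlinarith), _, Exec.seq he1 he2, ?_⟩
    generalize c.ops.eval N = o1 at *
    generalize d.ops.eval N = o2 at *
    generalize c.grow.eval N = g1 at *
    generalize d.grow.eval N = g2 at *
    have h5 : o1 * (b + g1 * (u + 1) + 1) ≤ o1 * (b + (g1 + g2) * (u + 1) + 1) := by
      gcongr; omega
    nlinarith
  | ite e c d ihc ihd =>
    simp only [Cmd.ok, Bool.and_eq_true] at hc
    have h2 := Expr.cost_le hc.1.1 (H0 s hs0) (Hw s hsw) hb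
    obtain ⟨hb1, t1, he1, ht1⟩ := ihc hc.1.2 hN.1 s b hs0 hsw hb
    obtain ⟨hb2, t2, he2, ht2⟩ := ihd hc.2 hN.2 s b hs0 hsw hb
    simp only [Cmd.grow, Cmd.ops, Polynomial.eval_add, Polynomial.eval_C]
    generalize c.ops.eval N = o1 at *
    generalize d.ops.eval N = o2 at *
    generalize c.grow.eval N = g1 at *
    generalize d.grow.eval N = g2 at *
    have h3 : e.len * (b + e.len * (u + 1) + 1) ≤
        e.len * (b + (e.len + g1 + g2) * (u + 1) + 1) := by gcongr; omega
    have h4 : o1 * (b + g1 * (u + 1) + 1) ≤ o1 * (b + (e.len + g1 + g2) * (u + 1) + 1) := by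
      gcongr; omega
    have h5 : o2 * (b + g2 * (u + 1) + 1) ≤ o2 * (b + (e.len + g1 + g2) * (u + 1) + 1) := by
      gcongr; omega
    by_cases h : e.eval s = 0
    · refine ⟨?_, e.cost s + t2 + 1, ?_, ?_⟩
      · simp only [Cmd.den, h, if_true]
        exact hb2.mono (by nlinarith)
      · simp only [Cmd.den, h, if_true]
        exact Exec.ite_false h he2
      · nlinarith
    · refine ⟨?_, e.cost s + t1 + 1, ?_, ?_⟩
      · simp only [Cmd.den, h, if_false]
        exact hb1.mono (by nlinarith)
      · simp only [Cmd.den, h, if_false]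
        exact Exec.ite_true h he1
      · nlinarith
  | loop x e c ihc =>
    simp only [Cmd.ok, Bool.and_eq_true, bne_iff_ne, ne_eq, Bool.not_eq_true',
      List.contains_eq_mem, decide_eq_false_iff_not] at hc
    obtain ⟨⟨⟨⟨hx0, hst⟩, heok⟩, hcok⟩, hxc⟩ := hc
    obtain ⟨hNe, hNc⟩ := hN
    specialize ihc hcok hNc
    set step : State → State := fun s' => (c.den s').setReg x ((c.den s').reg x + 1) with hstep
    generalize hg : c.grow.eval N = g at *
    generalize ho : c.ops.eval N = o at *
    have hes : e.eval s = e.eval s₀ := Expr.isStatic_eval hst hs0 hsw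
    obtain ⟨hb1, t1, he1, ht1⟩ := exec_while h0 hw hx0 hst heok hcok hxc ihc
      (e.eval s₀) (s.setReg x 0) b (by simp [Ne.symm hx0, hs0])
      (by simp [hsw]) (hb.setReg (by simp)) (by simp)
    simp only [Cmd.grow, Cmd.ops, Polynomial.eval_add, Polynomial.eval_C, Polynomial.eval_mul,
      Polynomial.eval_X, hg, ho, Polynomial.eval_ofNat]
    have hden : (Cmd.loop x e c).den s = step^[e.eval s₀] (s.setReg x 0) := by
      simp only [Cmd.den, hes, hstep]
    rw [hden]
    generalize e.eval s₀ = r at *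
    have m1 : r * (g + 3) ≤ N * (g + 3) := Nat.mul_le_mul_right _ hNe
    have m2 : r * (o + (e.len + 10)) ≤ N * (o + (e.len + 10)) := Nat.mul_le_mul_right _ hNe
    -- The actual number `r` of iterations is replaced by its bound `N`.
    have m3 : b + (r * (g + 3) + (e.len + 2)) * (u + 1) + 1 ≤
        b + (N * (g + 3) + (e.len + 2)) * (u + 1) + 1 := by gcongr
    refine ⟨hb1.mono (by nlinarith), _, Exec.seq (Exec.assign s x (.const 0)) he1, ?_⟩
    have m4 := Nat.mul_le_mul (Nat.add_le_add_right m2 (e.len + 3)) m3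
    have m5 := ht1.trans m4
    have m6 : (Expr.const 0).cost s = 1 := by simp [Expr.cost]
    have m7 : 1 ≤ b + (N * (g + 3) + (e.len + 2)) * (u + 1) + 1 := by omega
    generalize b + (N * (g + 3) + (e.len + 2)) * (u + 1) + 1 = Z at *
    rw [m6]
    nlinarith

end RAM

open Finset

/-! ### Polynomial time bounds -/

namespace RAM

/-- Natural coefficients make the polynomial monotone on nonnegative arguments; this allows
replacing `k` by a real upper bound. -/
lemma aeval_mono {σ : Type*} {f g : σ → ℝ} (hf : ∀ i, 0 ≤ f i) (hfg : ∀ i, f i ≤ g i)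
    (B : MvPolynomial σ ℕ) :
    0 ≤ MvPolynomial.aeval f B ∧ MvPolynomial.aeval f B ≤ MvPolynomial.aeval g B := by
  induction B using MvPolynomial.induction_on with
  | C a => simp
  | add p q hp hq =>
    simp only [map_add]
    exact ⟨add_nonneg hp.1 hq.1, add_le_add hp.2 hq.2⟩
  | mul_X p i hp =>
    simp only [map_mul, MvPolynomial.aeval_X]
    exact ⟨mul_nonneg hp.1 (hf i), mul_le_mul hp.2 (hfg i) (hf i) (hp.1.trans hp.2)⟩

lemma length_le_wordSize (w : List ℕ) : w.length ≤ wordSize w := by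
  induction w with
  | nil => simp
  | cons a w ih => simp only [wordSize, List.map_cons, List.sum_cons, List.length_cons] at *; omega

lemma size_le_wordSize {w : List ℕ} {a : ℕ} (ha : a ∈ w) : a.size ≤ wordSize w := by
  induction w with
  | nil => simp at ha
  | cons b w ih =>
    simp only [wordSize, List.map_cons, List.sum_cons] at *
    rcases List.mem_cons.1 ha with rfl | h
    · omega
    · have := ih h; omega

lemma size_le_self (k : ℕ) : k.size ≤ k := Nat.size_le.2 Nat.lt_two_pow_self

/-- A structured program runs in polynomial time if its loops are polynomially bounded. -/
theorem Cmd.exec_poly (c : Cmd) (hc : c.ok = true) :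
    ∃ B : MvPolynomial (Fin 2) ℕ, ∀ (k : ℕ) (w : List ℕ),
      c.LoopsLE (initState k w) ((wordSize w + 1) ^ 2 * (k + 1)) →
      ∃ t, Exec c.compile (initState k w) (c.den (initState k w)) t ∧
        ∀ x : ℝ, (k : ℝ) ≤ x + 1 → (t : ℝ) ≤ MvPolynomial.aeval ![(wordSize w : ℝ), x] B := by
  let X₀ : MvPolynomial (Fin 2) ℕ := MvPolynomial.X 0
  let X₁ : MvPolynomial (Fin 2) ℕ := MvPolynomial.X 1
  let N : MvPolynomial (Fin 2) ℕ := (X₀ + 1) ^ 2 * (X₁ + 1)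
  -- The bound of `Cmd.exec` with `b = u = wordSize w + k`, using the crude estimate `k.size ≤ k`;
  -- polynomiality in `1/ε` itself permits this.
  let Q : MvPolynomial (Fin 2) ℕ := Polynomial.aeval N c.ops *
    (X₀ + X₁ + Polynomial.aeval N c.grow * (X₀ + X₁ + 1) + 1)
  -- The shift absorbs the rounding in `k = ⌈x⌉ ≤ x + 1`.
  refine ⟨MvPolynomial.bind₁ ![X₀, X₁ + 1] Q, fun k w hN => ?_⟩
  have h0 : ((initState k w).reg 0).size ≤ wordSize w + k := by
    simpa [initState] using (size_le_self k).trans (Nat.le_add_left _ _)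
  have hw : ∀ i, ((initState k w).arr 0 i).size ≤ wordSize w + k := by
    intro i
    simp only [initState, if_true]
    by_cases h : i < w.length
    · rw [List.getD_eq_getElem _ _ h]
      exact (size_le_wordSize (List.getElem_mem h)).trans (Nat.le_add_right _ _)
    · rw [List.getD_eq_default _ _ (by omega)]; simp
  have hb : Bits (wordSize w + k) (initState k w) := by
    refine ⟨fun x => ?_, fun a i => ?_⟩
    · by_cases hx : x = 0
      · subst hx; exact h0
      · simp [initState, hx]
    · by_cases ha : a = 0
      · subst ha; exact hw i
      · simp [initState, ha]
  obtain ⟨-, t, ht, hle⟩ := Cmd.exec h0 hw c hc hN _ _ rfl rfl hb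
  refine ⟨t, ht, fun x hx => ?_⟩
  have hQ : MvPolynomial.aeval ![wordSize w, k] Q =
      c.ops.eval ((wordSize w + 1) ^ 2 * (k + 1)) * (wordSize w + k +
        c.grow.eval ((wordSize w + 1) ^ 2 * (k + 1)) * (wordSize w + k + 1) + 1) := by
    simp only [Q, N, X₀, X₁, map_mul, map_add, map_one, MvPolynomial.aeval_X,
      ← Polynomial.aeval_algHom_apply, map_pow]
    simp [Polynomial.aeval_def, Polynomial.eval₂_eq_eval_map]
  have hQ' : ((MvPolynomial.aeval ![wordSize w, k] Q : ℕ) : ℝ) =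
      MvPolynomial.aeval ![(wordSize w : ℝ), (k : ℝ)] Q := by
    have := MvPolynomial.aeval_algebraMap_apply ℝ ![wordSize w, k] Q
    simp only [eq_natCast] at this
    rw [← this]
    congr 2
    funext i
    fin_cases i <;> rfl
  have h1 : (t : ℝ) ≤ MvPolynomial.aeval ![(wordSize w : ℝ), (k : ℝ)] Q := by
    rw [← hQ', hQ]
    exact_mod_cast hle
  have h2 : MvPolynomial.aeval ![(wordSize w : ℝ), x] (MvPolynomial.bind₁ ![X₀, X₁ + 1] Q) =
      MvPolynomial.aeval ![(wordSize w : ℝ), x + 1] Q := by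
    rw [MvPolynomial.aeval_bind₁]
    congr 2
    funext i
    fin_cases i <;> simp [X₀, X₁]
  rw [h2]
  refine h1.trans (aeval_mono ?_ ?_ Q).2 <;> intro i <;> fin_cases i <;> simp [hx]

end RAM

/-! ### Tables of partial solutions -/

/-- Integer data of a set-union knapsack problem: items `0, …, n - 1`, a bound `P` for the
values of the solutions, the capacity plus one `C`, element sets, weights, and values. -/
structure KnapData where
  n : ℕ
  P : ℕ
  C : ℕ
  L : ℕ → Finset ℕ
  w : ℕ → ℕ
  v : ℕ → ℕ

namespace KnapData

variable (d : KnapData)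

/-- Weight of a set of items. -/
def wt (S : Finset ℕ) : ℕ := ∑ e ∈ S.biUnion d.L, d.w e

/-- Value of a set of items. -/
def val (S : Finset ℕ) : ℕ := ∑ i ∈ S, d.v i

/-- Bit mask of a set of items. -/
def mask (S : Finset ℕ) : ℕ := ∑ i ∈ S, 2 ^ i

/-- `P` bounds the values of the feasible sets of items. -/
def Bdd : Prop := ∀ S ⊆ range d.n, d.wt S < d.C → d.val S ≤ d.P

/-- The entry of a table at `p` stands for a set of items of value `p`; its complementary weight is
`r` and its mask is `k`. -/
def Entry (D : Finset ℕ) (p r k : ℕ) : Prop :=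
  ∃ S ⊆ D, d.val S = p ∧ mask S = k ∧ r + d.wt S = d.C

/-- The nonzero entries of the table are solutions. -/
def Sound (D : Finset ℕ) (r k : ℕ → ℕ) : Prop :=
  ∀ p ≤ d.P, r p ≠ 0 → d.Entry D p (r p) (k p)

/-- Every feasible set of items is dominated by an entry of the table. -/
def Complete (D : Finset ℕ) (r : ℕ → ℕ) : Prop :=
  ∀ S ⊆ D, d.wt S < d.C → ∃ p ≤ d.P, d.val S ≤ p ∧ d.C ≤ r p + d.wt S

variable {d}

lemma wt_mono {S T : Finset ℕ} (h : S ⊆ T) : d.wt S ≤ d.wt T :=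
  sum_le_sum_of_subset (biUnion_subset_biUnion_of_subset_left _ h)

lemma val_mono {S T : Finset ℕ} (h : S ⊆ T) : d.val S ≤ d.val T := sum_le_sum_of_subset h

lemma val_union {S T : Finset ℕ} (h : Disjoint S T) : d.val (S ∪ T) = d.val S + d.val T :=
  sum_union h

lemma mask_union {S T : Finset ℕ} (h : Disjoint S T) : mask (S ∪ T) = mask S + mask T :=
  sum_union h

lemma val_insert {i : ℕ} {S : Finset ℕ} (h : i ∉ S) : d.val (insert i S) = d.v i + d.val S :=
  sum_insert h

lemma mask_insert {i : ℕ} {S : Finset ℕ} (h : i ∉ S) : mask (insert i S) = 2 ^ i + mask S :=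
  sum_insert h

lemma wt_union {S T : Finset ℕ} (h : ∀ a ∈ S, ∀ b ∈ T, Disjoint (d.L a) (d.L b)) :
    d.wt (S ∪ T) = d.wt S + d.wt T := by
  unfold wt
  rw [union_biUnion]
  refine sum_union ?_
  simp only [disjoint_biUnion_left, disjoint_biUnion_right]
  exact fun b hb a ha => h a ha b hb

/-- A nonzero complementary weight means feasibility, and feasible values are at most `P`. This is
why the program may write entries without checking that they stay inside the row. -/
lemma Entry.wt_lt {D : Finset ℕ} {p r k : ℕ} (h : d.Entry D p r k) (hr : r ≠ 0) (hd : d.Bdd)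
    (hD : D ⊆ range d.n) : p ≤ d.P := by
  obtain ⟨S, hS, rfl, -, hw⟩ := h
  exact hd S (hS.trans hD) (by omega)

lemma Entry.mono {D E : Finset ℕ} {p r k : ℕ} (h : d.Entry D p r k) (hDE : D ⊆ E) :
    d.Entry E p r k := by
  obtain ⟨S, hS, h⟩ := h
  exact ⟨S, hS.trans hDE, h⟩

lemma Entry.add {D E : Finset ℕ} {p q r s k l : ℕ} (h : d.Entry D p r k) (h' : d.Entry E q s l)
    (hDE : Disjoint D E) (hL : ∀ a ∈ D, ∀ b ∈ E, Disjoint (d.L a) (d.L b)) (hrs : d.C ≤ r + s) :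
    d.Entry (D ∪ E) (p + q) (r + s - d.C) (k + l) := by
  obtain ⟨S, hS, rfl, rfl, hw⟩ := h
  obtain ⟨T, hT, rfl, rfl, hw'⟩ := h'
  have hdis : Disjoint S T := disjoint_of_subset_left hS (disjoint_of_subset_right hT hDE)
  refine ⟨S ∪ T, union_subset_union hS hT, val_union hdis, mask_union hdis, ?_⟩
  rw [wt_union fun a ha b hb => hL a (hS ha) b (hT hb)]
  omega

/-- Entries of a sound table are at most `C`, so a nonzero truncated difference `r p + s q - C`
forces both entries to be nonzero. -/
lemma Sound.add {D E : Finset ℕ} {r k s l : ℕ → ℕ} {p q : ℕ} (h : d.Sound D r k)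
    (h' : d.Sound E s l) (hp : p ≤ d.P) (hq : q ≤ d.P)
    (hDE : Disjoint D E) (hL : ∀ a ∈ D, ∀ b ∈ E, Disjoint (d.L a) (d.L b))
    (hrs : r p + s q - d.C ≠ 0) :
    d.Entry (D ∪ E) (p + q) (r p + s q - d.C) (k p + l q) := by
  have hr : ∀ {D : Finset ℕ} {r k : ℕ → ℕ} {p : ℕ}, d.Sound D r k → p ≤ d.P → r p ≤ d.C := by
    intro D r k p h hp
    by_cases h0 : r p = 0
    · omega
    · obtain ⟨S, -, -, -, hS⟩ := h p hp h0
      omega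
  have h1 := hr h hp
  have h2 := hr h' hq
  exact (h p hp (by omega)).add (h' q hq (by omega)) hDE hL (by omega)

/-- A feasible set splits into its parts in `D` and in `E`, both feasible. The entries dominating
the parts add up to a candidate that dominates the whole. -/
lemma Complete.add {D E : Finset ℕ} {r k s l t : ℕ → ℕ} (hd : d.Bdd) (h : d.Complete D r)
    (h' : d.Complete E s) (hr : d.Sound D r k) (hs : d.Sound E s l)
    (hD : D ⊆ range d.n) (hE : E ⊆ range d.n)
    (hDE : Disjoint D E) (hL : ∀ a ∈ D, ∀ b ∈ E, Disjoint (d.L a) (d.L b))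
    (ht : ∀ p ≤ d.P, ∀ q ≤ d.P, p + q ≤ d.P → r p + s q ≤ t (p + q) + d.C) :
    d.Complete (D ∪ E) t := by
  intro S hS hw
  have hSu : S = S ∩ D ∪ S ∩ E := by rw [← inter_union_distrib_left, inter_eq_left.2 hS]
  have hdis : Disjoint (S ∩ D) (S ∩ E) :=
    disjoint_of_subset_left inter_subset_right (disjoint_of_subset_right inter_subset_right hDE)
  have hwS : d.wt S = d.wt (S ∩ D) + d.wt (S ∩ E) := by
    conv_lhs => rw [hSu]
    exact wt_union fun a ha b hb => hL a (mem_inter.1 ha).2 b (mem_inter.1 hb).2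
  have hvS : d.val S = d.val (S ∩ D) + d.val (S ∩ E) := by
    conv_lhs => rw [hSu]
    exact val_union hdis
  obtain ⟨p, hp, hvp, hrp⟩ := h _ inter_subset_right (by omega : d.wt (S ∩ D) < d.C)
  obtain ⟨q, hq, hvq, hsq⟩ := h' _ inter_subset_right (by omega : d.wt (S ∩ E) < d.C)
  have hne : r p + s q - d.C ≠ 0 := by omega
  -- The combined entry is itself a feasible set, so nothing is lost by the finite width of the
  -- table.
  have hpq : p + q ≤ d.P := (hr.add hs hp hq hDE hL hne).wt_lt hne hd (union_subset hD hE)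
  refine ⟨p + q, hpq, by omega, ?_⟩
  have := ht p hp q hq hpq
  omega

lemma Complete.empty {r : ℕ → ℕ} (hr : r 0 = d.C) : d.Complete ∅ r := by
  intro S hS hw
  rw [subset_empty.1 hS] at hw ⊢
  exact ⟨0, by omega, by simp [val], by omega⟩

lemma Sound.empty {r k : ℕ → ℕ} (hr : r 0 = d.C) (hr' : ∀ p ≤ d.P, p ≠ 0 → r p = 0)
    (hk : k 0 = 0) : d.Sound ∅ r k := by
  intro p hp h
  by_cases h0 : p = 0
  · subst h0
    exact ⟨∅, subset_rfl, by simp [val], by simp [mask, hk], by simp [wt, hr]⟩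
  · exact absurd (hr' p hp h0) h

lemma wt_insert {i : ℕ} {D : Finset ℕ} (h : ∀ a ∈ D, d.L a ⊆ d.L i) :
    d.wt (insert i D) = d.wt {i} := by
  unfold wt
  rw [biUnion_insert, singleton_biUnion, union_eq_left.2 (biUnion_subset.2 h)]

/-- The whole subfamily of an item is a solution. -/
lemma entry_insert {i : ℕ} {D : Finset ℕ} (h : ∀ a ∈ D, d.L a ⊆ d.L i) (hi : i ∉ D)
    (hw : d.wt {i} < d.C) :
    d.Entry (insert i D) (d.v i + d.val D) (d.C - d.wt {i}) (2 ^ i + mask D) :=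
  ⟨insert i D, subset_rfl, val_insert hi, mask_insert hi, by rw [wt_insert h]; omega⟩

/-- A set containing `i` weighs at least as much as `{i}`, hence as all of `insert i D`, whose value
is at least as large. Sets avoiding `i` are dominated by the old table. -/
lemma Complete.insert {i : ℕ} {D : Finset ℕ} {r r' : ℕ → ℕ} (hd : d.Bdd) (h : d.Complete D r)
    (hL : ∀ a ∈ D, d.L a ⊆ d.L i) (hi : i ∉ D) (hD : insert i D ⊆ range d.n)
    (hr : ∀ p ≤ d.P, r p ≤ r' p)
    (hr' : d.v i + d.val D ≤ d.P → d.C - d.wt {i} ≤ r' (d.v i + d.val D)) :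
    d.Complete (insert i D) r' := by
  intro S hS hw
  by_cases hiS : i ∈ S
  · have h1 : d.wt {i} ≤ d.wt S := wt_mono (singleton_subset_iff.2 hiS)
    have h2 : d.v i + d.val D ≤ d.P :=
      (entry_insert hL hi (by omega)).wt_lt (by omega) hd hD
    have h3 := hr' h2
    exact ⟨_, h2, (val_insert hi).symm ▸ val_mono hS, by omega⟩
  · obtain ⟨p, hp, hv, hc⟩ := h S ((subset_insert_iff_of_notMem hiS).1 hS) hw
    have := hr p hp
    exact ⟨p, hp, hv, by omega⟩

/-- The last nonzero entry of a complete table is an optimal solution. -/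
lemma optimal {D : Finset ℕ} {r k : ℕ → ℕ} (hs : d.Sound D r k) (hc : d.Complete D r) {p : ℕ}
    (hp : p ≤ d.P) (hr : r p ≠ 0) (hmax : ∀ q ≤ d.P, p < q → r q = 0) :
    ∃ S ⊆ D, mask S = k p ∧ d.wt S < d.C ∧ ∀ T ⊆ D, d.wt T < d.C → d.val T ≤ d.val S := by
  obtain ⟨S, hS, hv, hm, hw⟩ := hs p hp hr
  refine ⟨S, hS, hm, by omega, fun T hT hwT => ?_⟩
  obtain ⟨q, hq, hvq, hcq⟩ := hc T hT hwT
  by_contra! h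
  have := hmax q hq (by omega)
  omega

/-- The bits of the mask are the members of the set. -/
lemma mask_bit (S : Finset ℕ) (i : ℕ) :
    mask S / 2 ^ i - 2 * (mask S / 2 ^ i / 2) ≠ 0 ↔ i ∈ S := by
  -- The left side of the goal is the residue mod `2` of the shifted mask, written without a
  -- remainder operation.
  have h : i ∈ S ↔ mask S / 2 ^ i % 2 = 1 := by
    conv_lhs => rw [← toFinset_bitIndices_sum_two_pow S]
    rw [List.mem_toFinset, Nat.mem_bitIndices, Nat.testBit_eq_decide_div_mod_eq,
      decide_eq_true_eq, mask]
  rw [h]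
  omega

end KnapData

/-! ### The program

Registers: `0` accuracy `k`, `1` common denominator, `2` capacity plus one, `3` element, `4` item,
`5`, `6` weight and cardinality of an element set, `7`, `8` numerator and denominator of the best
value of a feasible item, `9` power of two, `10` cardinality that is processed, `11` current table,
`12` root, `13` result of a test, `14`, `15` values in the tables, `16` new entry, `17`, `18` value
and mask of the subfamily of an item, `19` quotient, `20` table that is merged.

Arrays: `0` input, `1` output, `2` weights of the items, `3` cardinalities, `4`, `5` complementary
weights and masks in the tables, `6` powers of two, `7` marks of the roots, `8`, `9`, `10` tables,
values and masks of the subfamilies of the roots, `11` rounded values. -/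

namespace RAM

instance : Add Expr := ⟨Expr.add⟩
instance : Sub Expr := ⟨Expr.sub⟩
instance : Mul Expr := ⟨Expr.mul⟩
instance : Div Expr := ⟨Expr.div⟩
instance (n : ℕ) : OfNat Expr n := ⟨Expr.const n⟩

@[simp] lemma Expr.eval_add (s : State) (e f : Expr) : (e + f).eval s = e.eval s + f.eval s := rfl
@[simp] lemma Expr.eval_sub (s : State) (e f : Expr) : (e - f).eval s = e.eval s - f.eval s := rfl
@[simp] lemma Expr.eval_mul (s : State) (e f : Expr) : (e * f).eval s = e.eval s * f.eval s := rfl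
@[simp] lemma Expr.eval_div (s : State) (e f : Expr) : (e / f).eval s = e.eval s / f.eval s := rfl
@[simp] lemma Expr.eval_reg (s : State) (x : ℕ) : (Expr.reg x).eval s = s.reg x := rfl
@[simp] lemma Expr.eval_load (s : State) (a : ℕ) (e : Expr) :
    (Expr.load a e).eval s = s.arr a (e.eval s) := rfl
@[simp] lemma Expr.eval_zero (s : State) : (0 : Expr).eval s = 0 := rfl
@[simp] lemma Expr.eval_one (s : State) : (1 : Expr).eval s = 1 := rfl
@[simp] lemma Expr.eval_two (s : State) : (2 : Expr).eval s = 2 := rfl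
@[simp] lemma Expr.eval_three (s : State) : (3 : Expr).eval s = 3 := rfl
@[simp] lemma Expr.eval_four (s : State) : (4 : Expr).eval s = 4 := rfl

attribute [simp] Cmd.den.eq_1 Cmd.den.eq_2 Cmd.den.eq_3 Cmd.den.eq_4 Cmd.den.eq_5

end RAM

namespace LaminarKnapsack

open RAM RAM.Expr RAM.Cmd

local notation:60 c:61 " ;; " d:60 => Cmd.seq c d

/-- Number of items. -/
def nE : Expr := load 0 0

/-- Number of elements. -/
def mE : Expr := load 0 1

/-- Width of the tables. -/
def pE : Expr := reg 0 * (nE * nE) + 1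

/-- Numerator of the value of the item in the register `4`. -/
def vnE : Expr := load 0 (4 + reg 4)

/-- Denominator of the value of the item in the register `4`. -/
def vdE : Expr := load 0 (4 + nE + reg 4)

/-- Numerator of the weight of the element in the register `3`. -/
def wnE : Expr := load 0 (4 + (nE + nE) + reg 3)

/-- Denominator of the weight of the element in the register `3`. -/
def wdE : Expr := load 0 (4 + (nE + nE) + mE + reg 3)

/-- Incidence of the item in the register `x` and the element in the register `3`. -/
def incE (x : ℕ) : Expr := load 0 (4 + (nE + nE) + (mE + mE) + (reg x * mE + reg 3))

/-- Address of the entry `p` of the table `t`. -/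
def addr (t p : Expr) : Expr := reg 0 * (nE * (nE * t)) + t + p

/-- The common denominator of the weights and the capacity, and the integral capacity plus one. -/
def denCmd : Cmd :=
  assign 1 (load 0 3) ;;
  loop 3 mE (assign 1 (reg 1 * wdE)) ;;
  assign 2 (load 0 2 * (reg 1 / load 0 3) + 1)

/-- Weight and cardinality of the element set of the item in the register `4`. -/
def itemCmd : Cmd :=
  assign 5 0 ;;
  assign 6 0 ;;
  loop 3 mE
    (assign 5 (reg 5 + incE 4 * (wnE * (reg 1 / wdE))) ;;
     assign 6 (reg 6 + incE 4))

/-- Weights, cardinalities, powers of two, and the best value of a feasible item. -/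
def prepCmd : Cmd :=
  assign 7 0 ;;
  assign 8 1 ;;
  assign 9 1 ;;
  loop 4 nE
    (itemCmd ;;
     store 2 (reg 4) (reg 5) ;;
     store 3 (reg 4) (reg 6) ;;
     store 6 (reg 4) (reg 9) ;;
     assign 9 (reg 9 + reg 9) ;;
     ite (reg 2 - reg 5)
       (ite (vnE * reg 8 - vdE * reg 7) (assign 7 vnE ;; assign 8 vdE) skip)
       skip)

/-- Scaled and rounded values. -/
def scaleCmd : Cmd :=
  loop 4 nE (store 11 (reg 4) (vnE * (reg 0 * (nE * reg 8)) / (vdE * reg 7)))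

/-- Starts a new table for the empty set of items. -/
def newCmd : Cmd :=
  assign 11 (reg 11 + 1) ;;
  store 4 (addr (reg 11) 0) (reg 2)

/-- Combines an entry of the table in the register `11` with an entry of the table in the
register `20`. -/
def cellCmd : Cmd :=
  assign 16 (load 4 (addr (reg 11) (reg 14)) + load 4 (addr (reg 20) (reg 15)) - reg 2) ;;
  ite (reg 16 - load 4 (addr (reg 11 + 1) (reg 14 + reg 15)))
    (store 4 (addr (reg 11 + 1) (reg 14 + reg 15)) (reg 16) ;;
     store 5 (addr (reg 11 + 1) (reg 14 + reg 15))
       (load 5 (addr (reg 11) (reg 14)) + load 5 (addr (reg 20) (reg 15))))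
    skip

/-- Combines the tables in the registers `11` and `20` into a new table. -/
def convCmd : Cmd :=
  loop 14 pE (loop 15 pE cellCmd) ;;
  assign 11 (reg 11 + 1)

/-- Merges the root in the register `12` into the current table. -/
def joinCmd : Cmd :=
  assign 20 (load 8 (reg 12)) ;;
  convCmd ;;
  store 7 (reg 12) 0 ;;
  assign 17 (reg 17 + load 9 (reg 12)) ;;
  assign 18 (reg 18 + load 10 (reg 12))

/-- Merges all roots that pass a test into the current table. -/
def mergeCmd (test : Cmd) : Cmd :=
  loop 12 nE
    (ite (load 7 (reg 12)) (test ;; ite (reg 13) joinCmd skip) skip)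

/-- Tests whether the element sets of the items in the registers `4` and `12` meet. -/
def meetCmd : Cmd :=
  assign 13 0 ;;
  loop 3 mE (assign 13 (reg 13 + incE 4 * incE 12))

/-- Enters the union of the subfamily of an item into the current table. -/
def pointCmd : Cmd :=
  ite (reg 2 - load 2 (reg 4) - load 4 (addr (reg 11) (reg 17)))
    (store 4 (addr (reg 11) (reg 17)) (reg 2 - load 2 (reg 4)) ;;
     store 5 (addr (reg 11) (reg 17)) (reg 18))
    skip

/-- Makes the item in the register `4` a root. -/
def rootCmd : Cmd :=
  store 8 (reg 4) (reg 11) ;;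
  store 7 (reg 4) 1 ;;
  store 9 (reg 4) (reg 17) ;;
  store 10 (reg 4) (reg 18)

/-- Processes the item in the register `4`. -/
def processCmd : Cmd :=
  newCmd ;;
  assign 17 (load 11 (reg 4)) ;;
  assign 18 (load 6 (reg 4)) ;;
  mergeCmd meetCmd ;;
  pointCmd ;;
  rootCmd

/-- Processes the items by increasing cardinality of their element sets. -/
def forestCmd : Cmd :=
  loop 10 (mE + 1)
    (loop 4 nE
      (ite (1 - ((load 3 (reg 4) - reg 10) + (reg 10 - load 3 (reg 4)))) processCmd skip))

/-- Writes the members of the best solution in the current table to the output. -/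
def outputCmd : Cmd :=
  assign 18 0 ;;
  loop 14 pE
    (ite (load 4 (addr (reg 11) (reg 14))) (assign 18 (load 5 (addr (reg 11) (reg 14)))) skip) ;;
  loop 4 nE
    (assign 19 (reg 18 / load 6 (reg 4)) ;;
     store 1 (reg 4) (reg 19 - (reg 19 / 2 + reg 19 / 2)))

/-- Approximation scheme for laminar instances. -/
def schemeCmd : Cmd :=
  denCmd ;;
  prepCmd ;;
  scaleCmd ;;
  forestCmd ;;
  newCmd ;;
  mergeCmd (assign 13 1) ;;
  outputCmd

/-- This check is the reason for some detours in the program: doubling by addition, and addresses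
computed with `k` and `n` as factors instead of the stored width. -/
lemma schemeCmd_ok : schemeCmd.ok = true := by decide

@[simp] lemma eval_nE (s : State) : nE.eval s = s.arr 0 0 := rfl
@[simp] lemma eval_mE (s : State) : mE.eval s = s.arr 0 1 := rfl
@[simp] lemma eval_pE (s : State) : pE.eval s = s.reg 0 * (s.arr 0 0 * s.arr 0 0) + 1 := rfl
@[simp] lemma eval_vnE (s : State) : vnE.eval s = s.arr 0 (4 + s.reg 4) := rfl
@[simp] lemma eval_vdE (s : State) : vdE.eval s = s.arr 0 (4 + s.arr 0 0 + s.reg 4) := rfl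
@[simp] lemma eval_wnE (s : State) :
    wnE.eval s = s.arr 0 (4 + (s.arr 0 0 + s.arr 0 0) + s.reg 3) := rfl
@[simp] lemma eval_wdE (s : State) :
    wdE.eval s = s.arr 0 (4 + (s.arr 0 0 + s.arr 0 0) + s.arr 0 1 + s.reg 3) := rfl

/-- Incidence of the item `i` and the element `e` in the input. -/
def inc (A : ℕ → ℕ) (i e : ℕ) : ℕ := A (4 + (A 0 + A 0) + (A 1 + A 1) + (i * A 1 + e))

@[simp] lemma eval_incE (s : State) (x : ℕ) :
    (incE x).eval s = inc (s.arr 0) (s.reg x) (s.reg 3) := rfl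

@[simp] lemma eval_addr (s : State) (t p : Expr) : (addr t p).eval s =
    s.reg 0 * (s.arr 0 0 * (s.arr 0 0 * t.eval s)) + t.eval s + p.eval s := rfl

lemma schemeCmd_loopsLE {s : State} {N : ℕ} (hn : s.arr 0 0 ≤ N) (hm : s.arr 0 1 + 1 ≤ N)
    (hp : s.reg 0 * (s.arr 0 0 * s.arr 0 0) + 1 ≤ N) : schemeCmd.LoopsLE s N := by
  have hm' : s.arr 0 1 ≤ N := by omega
  simp [schemeCmd, denCmd, prepCmd, scaleCmd, forestCmd, newCmd, mergeCmd, outputCmd, itemCmd,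
    processCmd, pointCmd, rootCmd, meetCmd, joinCmd, convCmd, cellCmd, LoopsLE, hn, hm, hm', hp]

/-! ### Tables in the memory -/

variable {d : KnapData}

/-- The row `t` of the tables. -/
def row (d : KnapData) (f : ℕ → ℕ) (t p : ℕ) : ℕ := f (t * (d.P + 1) + p)

/-- The table `t` stands for the set of items `D`. -/
def TableOK (d : KnapData) (f g : ℕ → ℕ) (t : ℕ) (D : Finset ℕ) : Prop :=
  d.Sound D (row d f t) (row d g t) ∧ d.Complete D (row d f t)

/-- The tables after the table `t` are empty. -/
def Fresh (d : KnapData) (f g : ℕ → ℕ) (t : ℕ) : Prop :=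
  ∀ x, (t + 1) * (d.P + 1) ≤ x → f x = 0 ∧ g x = 0

/-- The tables up to `t` are unchanged. -/
def Same (d : KnapData) (f g f' g' : ℕ → ℕ) (t : ℕ) : Prop :=
  ∀ x, x < (t + 1) * (d.P + 1) → f' x = f x ∧ g' x = g x

lemma row_lt {t u p : ℕ} (htu : t ≤ u) (hp : p ≤ d.P) :
    t * (d.P + 1) + p < (u + 1) * (d.P + 1) := by
  have := Nat.mul_le_mul_right (d.P + 1) htu
  rw [add_mul u 1]
  omega

lemma Same.refl (f g : ℕ → ℕ) (t : ℕ) : Same d f g f g t := fun _ _ => ⟨rfl, rfl⟩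

lemma Same.row {f g f' g' : ℕ → ℕ} {t u p : ℕ} (h : Same d f g f' g' u) (htu : t ≤ u)
    (hp : p ≤ d.P) : row d f' t p = row d f t p ∧ row d g' t p = row d g t p :=
  h _ (row_lt htu hp)

lemma TableOK.same {f g f' g' : ℕ → ℕ} {t u : ℕ} {D : Finset ℕ} (h : TableOK d f g t D)
    (hs : Same d f g f' g' u) (htu : t ≤ u) : TableOK d f' g' t D := by
  refine ⟨fun p hp hr => ?_, fun S hS hw => ?_⟩
  · rw [(hs.row htu hp).1] at hr ⊢
    rw [(hs.row htu hp).2]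
    exact h.1 p hp hr
  · obtain ⟨p, hp, hv, hc⟩ := h.2 S hS hw
    exact ⟨p, hp, hv, by rwa [(hs.row htu hp).1]⟩

lemma Fresh.row {f g : ℕ → ℕ} {t p : ℕ} (h : Fresh d f g t) :
    row d f (t + 1) p = 0 ∧ row d g (t + 1) p = 0 :=
  h _ (Nat.le_add_right _ _)

/-- Effect of a new entry in the last table. -/
lemma row_update {f : ℕ → ℕ} {t p q a : ℕ} :
    row d (Function.update f (t * (d.P + 1) + q) a) t p = if p = q then a else row d f t p := by
  simp only [row, Function.update_apply, Nat.add_left_cancel_iff]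

lemma Same.update {f g f' g' : ℕ → ℕ} {t q a b : ℕ} (h : Same d f g f' g' t) :
    Same d f g (Function.update f' ((t + 1) * (d.P + 1) + q) a)
      (Function.update g' ((t + 1) * (d.P + 1) + q) b) t := by
  intro x hx
  rw [Function.update_of_ne (by omega), Function.update_of_ne (by omega)]
  exact h x hx

lemma Fresh.update {f g : ℕ → ℕ} {t q a b : ℕ} (h : Fresh d f g t) (hq : q ≤ d.P) :
    Fresh d (Function.update f (t * (d.P + 1) + q) a)
      (Function.update g (t * (d.P + 1) + q) b) t := by
  intro x hx
  have := row_lt (d := d) (le_refl t) hq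
  rw [Function.update_of_ne (by omega), Function.update_of_ne (by omega)]
  exact h x hx

/-! ### Convolution of two tables -/

/-- Invariant of the combination of the tables `t` and `u` of `D` and `E`. -/
structure ConvInv (d : KnapData) (t u : ℕ) (D E : Finset ℕ) (f₀ g₀ : ℕ → ℕ) (p q : ℕ)
    (f g : ℕ → ℕ) : Prop where
  same : Same d f₀ g₀ f g t
  fresh : Fresh d f g (t + 1)
  sound : d.Sound (D ∪ E) (row d f (t + 1)) (row d g (t + 1))
  above : ∀ p' q', (p' < p ∨ p' = p ∧ q' < q) → q' ≤ d.P → p' + q' ≤ d.P →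
    row d f₀ t p' + row d f₀ u q' ≤ row d f (t + 1) (p' + q') + d.C

lemma ConvInv.init {t u : ℕ} {D E : Finset ℕ} {f₀ g₀ : ℕ → ℕ} (h : Fresh d f₀ g₀ t) :
    ConvInv d t u D E f₀ g₀ 0 0 f₀ g₀ where
  same := Same.refl _ _ _
  fresh := fun x hx => h x (by rw [add_mul] at hx; omega)
  sound := fun p _ hr => absurd h.row.1 hr
  above := by omega

lemma ConvInv.next {t u : ℕ} {D E : Finset ℕ} {f₀ g₀ f g : ℕ → ℕ} {p : ℕ}
    (h : ConvInv d t u D E f₀ g₀ p (d.P + 1) f g) : ConvInv d t u D E f₀ g₀ (p + 1) 0 f g :=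
  { h with above := fun p' q' hpq hq => h.above p' q' (by omega) hq }

/-- The new table keeps the maximum of its entry and the candidate. A candidate that improves is
nonzero, hence an entry, hence of value at most `P`. A candidate with `p + q > P` vanishes, so
reading past the end of the row is harmless. -/
lemma ConvInv.step {t u : ℕ} {D E : Finset ℕ} {f₀ g₀ f g : ℕ → ℕ} {p q : ℕ} (hd : d.Bdd)
    (hD : TableOK d f₀ g₀ t D) (hE : TableOK d f₀ g₀ u E) (hut : u ≤ t)
    (hDn : D ⊆ range d.n) (hEn : E ⊆ range d.n) (hDE : Disjoint D E)
    (hL : ∀ a ∈ D, ∀ b ∈ E, Disjoint (d.L a) (d.L b))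
    (h : ConvInv d t u D E f₀ g₀ p q f g) (hp : p ≤ d.P) (hq : q ≤ d.P) :
    (row d f t p + row d f u q - d.C - row d f (t + 1) (p + q) = 0 →
      ConvInv d t u D E f₀ g₀ p (q + 1) f g) ∧
    (row d f t p + row d f u q - d.C - row d f (t + 1) (p + q) ≠ 0 →
      ConvInv d t u D E f₀ g₀ p (q + 1)
        (Function.update f ((t + 1) * (d.P + 1) + (p + q)) (row d f t p + row d f u q - d.C))
        (Function.update g ((t + 1) * (d.P + 1) + (p + q)) (row d g t p + row d g u q))) := by
  -- Only table `t + 1` is written and `u ≤ t`, so both sources still have their original content.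
  obtain ⟨hf1, hg1⟩ := h.same.row le_rfl hp
  obtain ⟨hf2, hg2⟩ := h.same.row hut hq
  rw [hf1, hf2, hg1, hg2]
  constructor
  · intro h0
    refine { h with above := fun p' q' hpq hq' hpq' => ?_ }
    by_cases hc : p' = p ∧ q' = q
    · obtain ⟨rfl, rfl⟩ := hc
      omega
    · exact h.above p' q' (by omega) hq' hpq'
  · intro h0
    have hent := hD.1.add hE.1 hp hq hDE hL (by omega)
    have hpq := hent.wt_lt (by omega) hd (union_subset hDn hEn)
    refine ⟨h.same.update, h.fresh.update hpq, fun p' hp' => ?_, fun p' q' hpq0 hq' hpq' => ?_⟩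
    · rw [row_update, row_update]
      split_ifs with hc
      · subst hc
        exact fun _ => hent
      · exact h.sound p' hp'
    · rw [row_update]
      split_ifs with hc
      · by_cases hc' : p' = p ∧ q' = q
        · obtain ⟨rfl, rfl⟩ := hc'
          omega
        · have := h.above p' q' (by omega) hq' hpq'
          rw [hc] at this
          omega
      · exact h.above p' q' (by omega) hq' hpq'

lemma ConvInv.final {t u : ℕ} {D E : Finset ℕ} {f₀ g₀ f g : ℕ → ℕ} (hd : d.Bdd)
    (hD : TableOK d f₀ g₀ t D) (hE : TableOK d f₀ g₀ u E)
    (hDn : D ⊆ range d.n) (hEn : E ⊆ range d.n) (hDE : Disjoint D E)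
    (hL : ∀ a ∈ D, ∀ b ∈ E, Disjoint (d.L a) (d.L b))
    (h : ConvInv d t u D E f₀ g₀ (d.P + 1) 0 f g) :
    TableOK d f g (t + 1) (D ∪ E) :=
  ⟨h.sound, hD.2.add hd hE.2 hD.1 hE.1 hDn hEn hDE hL
    fun p' hp' q' hq' => h.above p' q' (by omega) hq'⟩

/-! ### Verification of the program -/

/-- The input and the preprocessed data in the memory. -/
structure Ready (d : KnapData) (k : ℕ) (A : ℕ → ℕ) (s : State) : Prop where
  hk : s.reg 0 = k
  hA : s.arr 0 = A
  hn : d.n = A 0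
  hP : d.P = k * (A 0 * A 0)
  hL : ∀ i < d.n, d.L i = (range (A 1)).filter fun e => inc A i e ≠ 0
  hC : s.reg 2 = d.C
  hw : ∀ i < d.n, s.arr 2 i = d.wt {i}
  hc : ∀ i < d.n, s.arr 3 i = (d.L i).card
  h2 : ∀ i < d.n, s.arr 6 i = 2 ^ i
  hv : ∀ i < d.n, s.arr 11 i = d.v i

variable {k : ℕ} {A : ℕ → ℕ} {s s' : State}

lemma Ready.frame {R B : List ℕ} (h : Ready d k A s) (hf : Frame R B s s')
    (hR : 0 ∉ R ∧ 2 ∉ R) (hB : 0 ∉ B ∧ 2 ∉ B ∧ 3 ∉ B ∧ 6 ∉ B ∧ 11 ∉ B) : Ready d k A s' where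
  hk := (hf.1 0 hR.1).trans h.hk
  hA := (hf.2 0 hB.1).trans h.hA
  hn := h.hn
  hP := h.hP
  hL := h.hL
  hC := (hf.1 2 hR.2).trans h.hC
  hw := by rw [hf.2 2 hB.2.1]; exact h.hw
  hc := by rw [hf.2 3 hB.2.2.1]; exact h.hc
  h2 := by rw [hf.2 6 hB.2.2.2.1]; exact h.h2
  hv := by rw [hf.2 11 hB.2.2.2.2]; exact h.hv

/-- The left side is the form in which the program computes the address, with an input number in
each product. -/
lemma Ready.addr_eq (h : Ready d k A s) (t p : ℕ) :
    k * (A 0 * (A 0 * t)) + t + p = t * (d.P + 1) + p := by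
  rw [h.hP]; ring

lemma cellCmd_spec (h : Ready d k A s) :
    (row d (s.arr 4) (s.reg 11) (s.reg 14) + row d (s.arr 4) (s.reg 20) (s.reg 15) - d.C
        - row d (s.arr 4) (s.reg 11 + 1) (s.reg 14 + s.reg 15) = 0 →
      (cellCmd.den s).arr 4 = s.arr 4 ∧ (cellCmd.den s).arr 5 = s.arr 5) ∧
    (row d (s.arr 4) (s.reg 11) (s.reg 14) + row d (s.arr 4) (s.reg 20) (s.reg 15) - d.C
        - row d (s.arr 4) (s.reg 11 + 1) (s.reg 14 + s.reg 15) ≠ 0 →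
      (cellCmd.den s).arr 4 = Function.update (s.arr 4)
        ((s.reg 11 + 1) * (d.P + 1) + (s.reg 14 + s.reg 15))
        (row d (s.arr 4) (s.reg 11) (s.reg 14) + row d (s.arr 4) (s.reg 20) (s.reg 15) - d.C) ∧
      (cellCmd.den s).arr 5 = Function.update (s.arr 5)
        ((s.reg 11 + 1) * (d.P + 1) + (s.reg 14 + s.reg 15))
        (row d (s.arr 5) (s.reg 11) (s.reg 14) + row d (s.arr 5) (s.reg 20) (s.reg 15))) := by
  simp only [row]
  constructor <;> intro h0 <;> simp [cellCmd, h.hk, h.hA, h.hC, h.addr_eq, h0]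

/-- Each convolution writes into an unused table, so older tables, in particular those of the roots,
survive. -/
lemma convCmd_spec (hd : d.Bdd) (h : Ready d k A s) {D E : Finset ℕ}
    (hD : TableOK d (s.arr 4) (s.arr 5) (s.reg 11) D)
    (hE : TableOK d (s.arr 4) (s.arr 5) (s.reg 20) E) (hut : s.reg 20 ≤ s.reg 11)
    (hDn : D ⊆ range d.n) (hEn : E ⊆ range d.n) (hDE : Disjoint D E)
    (hL : ∀ a ∈ D, ∀ b ∈ E, Disjoint (d.L a) (d.L b))
    (hF : Fresh d (s.arr 4) (s.arr 5) (s.reg 11)) :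
    (convCmd.den s).reg 11 = s.reg 11 + 1 ∧
    Same d (s.arr 4) (s.arr 5) ((convCmd.den s).arr 4) ((convCmd.den s).arr 5) (s.reg 11) ∧
    Fresh d ((convCmd.den s).arr 4) ((convCmd.den s).arr 5) (s.reg 11 + 1) ∧
    TableOK d ((convCmd.den s).arr 4) ((convCmd.den s).arr 5) (s.reg 11 + 1) (D ∪ E) := by
  have key := Cmd.loop_inv (x := 14) (e := pE) (c := loop 15 pE cellCmd) (s := s)
    (fun p s' => ConvInv d (s.reg 11) (s.reg 20) D E (s.arr 4) (s.arr 5) p 0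
      (s'.arr 4) (s'.arr 5)) (by decide) (b := d.P + 1) (by simp [h.hk, h.hA, h.hP])
      (by simpa using ConvInv.init hF) (by
    intro p s1 hp hf1 hp1 hI
    have h1 : Ready d k A s1 := h.frame hf1 (by decide) (by decide)
    have key2 := Cmd.loop_inv (x := 15) (e := pE) (c := cellCmd) (s := s1)
      (fun q s' => ConvInv d (s.reg 11) (s.reg 20) D E (s.arr 4) (s.arr 5) p q
        (s'.arr 4) (s'.arr 5)) (by decide) (b := d.P + 1) (by simp [h1.hk, h1.hA, h1.hP])
        (by simpa using hI) (by
      intro q s2 hq hf2 hq2 hJ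
      have h2 : Ready d k A s2 := h1.frame hf2 (by decide) (by decide)
      have r11 : s2.reg 11 = s.reg 11 := (hf2.1 11 (by decide)).trans (hf1.1 11 (by decide))
      have r20 : s2.reg 20 = s.reg 20 := (hf2.1 20 (by decide)).trans (hf1.1 20 (by decide))
      have r14 : s2.reg 14 = p := (hf2.1 14 (by decide)).trans hp1
      have hst := hJ.step hd hD hE hut hDn hEn hDE hL (by omega) (by omega)
      have hcell := cellCmd_spec h2
      rw [r11, r20, r14, hq2] at hcell
      simp only [State.setReg_arr]
      by_cases h0 : row d (s2.arr 4) (s.reg 11) p + row d (s2.arr 4) (s.reg 20) q - d.C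
        - row d (s2.arr 4) (s.reg 11 + 1) (p + q) = 0
      · rw [(hcell.1 h0).1, (hcell.1 h0).2]
        exact hst.1 h0
      · rw [(hcell.2 h0).1, (hcell.2 h0).2]
        exact hst.2 h0)
    simpa using key2.next)
  have r11 : ((loop 14 pE (loop 15 pE cellCmd)).den s).reg 11 = s.reg 11 :=
    den_reg _ _ (by decide)
  have hfin := key.final hd hD hE hDn hEn hDE hL
  simp only [convCmd, den.eq_4, den.eq_2, State.setReg_arr, State.setReg_reg]
  exact ⟨by simp [r11], key.same, key.fresh, hfin⟩

/-! ### The forest of roots and the merging of tables -/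

/-- The roots `R` of the forest of the processed items, with the sets `D j` of the items below
them, and their tables. -/
structure Forest (d : KnapData) (D : ℕ → Finset ℕ) (R : Finset ℕ) (s : State) : Prop where
  lt : R ⊆ range d.n
  root : ∀ j < d.n, s.arr 7 j ≠ 0 ↔ j ∈ R
  sub : ∀ j ∈ R, D j ⊆ range d.n
  le : ∀ j ∈ R, s.arr 8 j ≤ s.reg 11
  table : ∀ j ∈ R, TableOK d (s.arr 4) (s.arr 5) (s.arr 8 j) (D j)
  val : ∀ j ∈ R, s.arr 9 j = d.val (D j)
  mask : ∀ j ∈ R, s.arr 10 j = KnapData.mask (D j)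
  sets : ∀ j ∈ R, ∀ a ∈ D j, d.L a ⊆ d.L j
  disj : ∀ j ∈ R, ∀ j' ∈ R, j ≠ j' → Disjoint (D j) (D j') ∧ Disjoint (d.L j) (d.L j')
  fresh : Fresh d (s.arr 4) (s.arr 5) (s.reg 11)

lemma Forest.frame {D : ℕ → Finset ℕ} {R : Finset ℕ} {X B : List ℕ} (h : Forest d D R s)
    (hf : Frame X B s s') (hX : 11 ∉ X)
    (hB : 4 ∉ B ∧ 5 ∉ B ∧ 7 ∉ B ∧ 8 ∉ B ∧ 9 ∉ B ∧ 10 ∉ B) : Forest d D R s' where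
  lt := h.lt
  root := by rw [hf.2 7 (by tauto)]; exact h.root
  sub := h.sub
  le := by rw [hf.2 8 (by tauto), hf.1 11 hX]; exact h.le
  table := by rw [hf.2 8 (by tauto), hf.2 4 (by tauto), hf.2 5 (by tauto)]; exact h.table
  val := by rw [hf.2 9 (by tauto)]; exact h.val
  mask := by rw [hf.2 10 (by tauto)]; exact h.mask
  sets := h.sets
  disj := h.disj
  fresh := by rw [hf.1 11 hX, hf.2 4 (by tauto), hf.2 5 (by tauto)]; exact h.fresh

/-- Passing to a subset of the roots, while new tables are added. -/
lemma Forest.step {D : ℕ → Finset ℕ} {R R' : Finset ℕ} (h : Forest d D R s) (hR : R' ⊆ R)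
    (h11 : s.reg 11 ≤ s'.reg 11) (hroot : ∀ j < d.n, s'.arr 7 j ≠ 0 ↔ j ∈ R')
    (h8 : s'.arr 8 = s.arr 8) (h9 : s'.arr 9 = s.arr 9) (h10 : s'.arr 10 = s.arr 10)
    {T : ℕ} (hT : ∀ j ∈ R', s.arr 8 j ≤ T)
    (hs : Same d (s.arr 4) (s.arr 5) (s'.arr 4) (s'.arr 5) T)
    (hf : Fresh d (s'.arr 4) (s'.arr 5) (s'.reg 11)) : Forest d D R' s' where
  lt := hR.trans h.lt
  root := hroot
  sub := fun j hj => h.sub j (hR hj)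
  le := fun j hj => by rw [h8]; exact (h.le j (hR hj)).trans h11
  table := fun j hj => by rw [h8]; exact (h.table j (hR hj)).same hs (hT j hj)
  val := fun j hj => by rw [h9]; exact h.val j (hR hj)
  mask := fun j hj => by rw [h10]; exact h.mask j (hR hj)
  sets := fun j hj => h.sets j (hR hj)
  disj := fun j hj j' hj' => h.disj j (hR hj) j' (hR hj')
  fresh := hf

/-- The current table stands for the set of items `E`; values and masks are accumulated from `v`
and `m`, and `T` is an older table. -/
structure Current (d : KnapData) (T v m : ℕ) (E : Finset ℕ) (s : State) : Prop where
  lt : T < s.reg 11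
  table : TableOK d (s.arr 4) (s.arr 5) (s.reg 11) E
  val : s.reg 17 = v + d.val E
  mask : s.reg 18 = m + KnapData.mask E

lemma Current.frame {T v m : ℕ} {E : Finset ℕ} {X B : List ℕ} (h : Current d T v m E s)
    (hf : Frame X B s s') (hX : 11 ∉ X ∧ 17 ∉ X ∧ 18 ∉ X) (hB : 4 ∉ B ∧ 5 ∉ B) :
    Current d T v m E s' where
  lt := by rw [hf.1 11 hX.1]; exact h.lt
  table := by rw [hf.2 4 hB.1, hf.2 5 hB.2, hf.1 11 hX.1]; exact h.table
  val := by rw [hf.1 17 hX.2.1]; exact h.val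
  mask := by rw [hf.1 18 hX.2.2]; exact h.mask

lemma newCmd_spec {D : ℕ → Finset ℕ} {R : Finset ℕ} (h : Ready d k A s) (hF : Forest d D R s) :
    Forest d D R (newCmd.den s) ∧ (newCmd.den s).reg 11 = s.reg 11 + 1 ∧
    TableOK d ((newCmd.den s).arr 4) ((newCmd.den s).arr 5) ((newCmd.den s).reg 11) ∅ := by
  have e4 : (newCmd.den s).arr 4 =
      Function.update (s.arr 4) ((s.reg 11 + 1) * (d.P + 1) + 0) d.C := by
    simp [newCmd, h.hk, h.hA, h.hC, ← h.addr_eq]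
  have e5 : (newCmd.den s).arr 5 = s.arr 5 := den_arr _ _ (by decide)
  have e11 : (newCmd.den s).reg 11 = s.reg 11 + 1 := by simp [newCmd]
  have hrow : ∀ p ≤ d.P, row d ((newCmd.den s).arr 4) (s.reg 11 + 1) p =
      if p = 0 then d.C else 0 := by
    intro p hp
    rw [e4, row_update, hF.fresh.row.1]
  refine ⟨hF.step subset_rfl (by omega) ?_ (den_arr _ _ (by decide)) (den_arr _ _ (by decide))
    (den_arr _ _ (by decide)) hF.le ?_ ?_, e11, ?_, ?_⟩
  · rw [den_arr _ _ (by decide)]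
    exact hF.root
  · rw [e4, e5]
    intro x hx
    rw [Function.update_of_ne (by omega)]
    exact ⟨rfl, rfl⟩
  · rw [e4, e5, e11]
    intro x hx
    rw [Function.update_of_ne]
    · exact hF.fresh x (by rw [add_mul] at hx; omega)
    · rw [add_mul _ 1] at hx; omega
  · rw [e11]
    refine KnapData.Sound.empty (by simpa using hrow 0 (by omega)) ?_ ?_
    · intro p hp h0
      rw [hrow p hp, if_neg h0]
    · rw [e5]
      exact hF.fresh.row.2
  · rw [e11]
    exact KnapData.Complete.empty (by simpa using hrow 0 (by omega))

/-- The items below a root have element sets inside that of the root, so disjointness from the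
root's set suffices for weights to add. The root only loses its mark. -/
lemma joinCmd_spec (hd : d.Bdd) {D : ℕ → Finset ℕ} {R E : Finset ℕ} {T v m : ℕ}
    (h : Ready d k A s) (hF : Forest d D R s) (hE : Current d T v m E s) (hj : s.reg 12 ∈ R)
    (hEn : E ⊆ range d.n) (hED : Disjoint E (D (s.reg 12)))
    (hL : ∀ a ∈ E, Disjoint (d.L a) (d.L (s.reg 12))) :
    Forest d D (R.erase (s.reg 12)) (joinCmd.den s) ∧
    Current d T v m (E ∪ D (s.reg 12)) (joinCmd.den s) := by
  set s1 := (assign 20 (load 8 (reg 12))).den s with hs1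
  have f1 : Frame [20] [] s s1 := den_frame (assign 20 (load 8 (reg 12))) _
  have h1 : Ready d k A s1 := h.frame f1 (by decide) (by decide)
  have hF1 : Forest d D R s1 := hF.frame f1 (by decide) (by decide)
  have hE1 : Current d T v m E s1 := hE.frame f1 (by decide) (by decide)
  have r20 : s1.reg 20 = s1.arr 8 (s.reg 12) := by simp [hs1]
  have r12 : s1.reg 12 = s.reg 12 := by simp [hs1]
  obtain ⟨c11, csame, cfresh, ctab⟩ := convCmd_spec hd h1 hE1.table
    (by rw [r20]; exact hF1.table _ hj) (by rw [r20]; exact hF1.le _ hj) hEn (hF.sub _ hj) hED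
    (fun a ha b hb => disjoint_of_subset_right (hF.sets _ hj b hb) (hL a ha)) hF1.fresh
  have hden : joinCmd.den s =
      (store 7 (reg 12) 0 ;; (assign 17 (reg 17 + load 9 (reg 12)) ;;
        assign 18 (reg 18 + load 10 (reg 12)))).den (convCmd.den s1) := rfl
  set s2 := convCmd.den s1 with hs2
  have f2 : Frame convCmd.regs convCmd.arrs s1 s2 := den_frame _ _
  have r12' : s2.reg 12 = s.reg 12 := (f2.1 12 (by decide)).trans r12
  have a7 : (joinCmd.den s).arr 7 = Function.update (s1.arr 7) (s.reg 12) 0 := by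
    rw [hden]; simp [r12', f2.2 7 (by decide)]
  have a4 : (joinCmd.den s).arr 4 = s2.arr 4 := by rw [hden]; simp
  have a5 : (joinCmd.den s).arr 5 = s2.arr 5 := by rw [hden]; simp
  have a11 : (joinCmd.den s).reg 11 = s1.reg 11 + 1 := by rw [hden]; simp [c11]
  have a17 : (joinCmd.den s).reg 17 = s1.reg 17 + s1.arr 9 (s.reg 12) := by
    rw [hden]; simp [r12', f2.2 9 (by decide), f2.1 17 (by decide)]
  have a18 : (joinCmd.den s).reg 18 = s1.reg 18 + s1.arr 10 (s.reg 12) := by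
    rw [hden]; simp [r12', f2.2 10 (by decide), f2.1 18 (by decide)]
  refine ⟨hF1.step (erase_subset _ _) (by omega) ?_ ?_ ?_ ?_
    (fun j hj => hF1.le j (erase_subset _ _ hj)) ?_ ?_, ?_, ?_, ?_, ?_⟩
  · intro j hjn
    rw [a7, Function.update_apply, mem_erase, ← hF1.root j hjn]
    split_ifs with hc <;> simp [hc]
  · exact ((joinCmd.den_frame s).2 8 (by decide)).trans (f1.2 8 (by decide)).symm
  · exact ((joinCmd.den_frame s).2 9 (by decide)).trans (f1.2 9 (by decide)).symm
  · exact ((joinCmd.den_frame s).2 10 (by decide)).trans (f1.2 10 (by decide)).symm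
  · rw [a4, a5]; exact csame
  · rw [a4, a5, a11]; exact cfresh
  · have := hE1.lt
    omega
  · rw [a4, a5, a11]; exact ctab
  · rw [a17, hE1.val, hF1.val _ hj, KnapData.val_union hED, add_assoc]
  · rw [a18, hE1.mask, hF1.mask _ hj, KnapData.mask_union hED, add_assoc]

/-- Roots below `j` that satisfy `Q`. -/
def joined (Q : ℕ → Prop) [DecidablePred Q] (R : Finset ℕ) (j : ℕ) : Finset ℕ :=
  R.filter fun a => Q a ∧ a < j

/-- Roots are pairwise disjoint, so they may be convolved one after the other. The invariant says
that exactly the roots below the counter satisfying `Q` have moved from the forest into the current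
table. -/
lemma mergeCmd_spec (hd : d.Bdd) {test : Cmd} (ht : test = meetCmd ∨ test = assign 13 1)
    (Q : ℕ → Prop) [DecidablePred Q] {D : ℕ → Finset ℕ} {R : Finset ℕ} {T v m : ℕ}
    (hQ : ∀ s', Ready d k A s' → s'.reg 4 = s.reg 4 → s'.reg 12 < d.n →
      ((test.den s').reg 13 ≠ 0 ↔ Q (s'.reg 12)))
    (h : Ready d k A s) (hF : Forest d D R s) (hE : Current d T v m ∅ s) :
    Forest d D (R.filter fun j => ¬ Q j) ((mergeCmd test).den s) ∧
    Current d T v m ((R.filter Q).biUnion D) ((mergeCmd test).den s) := by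
  have key := Cmd.loop_inv (x := 12) (e := nE)
    (c := ite (load 7 (reg 12)) (test ;; ite (reg 13) joinCmd skip) skip) (s := s)
    (fun j s' => Forest d D (R \ joined Q R j) s' ∧ Current d T v m ((joined Q R j).biUnion D) s')
    (by rcases ht with rfl | rfl <;> decide) (b := d.n) (by simp [h.hA, h.hn]) (by
      have f0 : Frame [12] [] s (s.setReg 12 0) := Frame.setReg (by decide) _ _
      simp only [joined, Nat.not_lt_zero, and_false, filter_false, sdiff_empty, biUnion_empty]
      exact ⟨hF.frame f0 (by decide) (by decide), hE.frame f0 (by decide) (by decide)⟩) (by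
    rintro j s1 hjn hf1 hj1 ⟨hF1, hE1⟩
    have h1 : Ready d k A s1 := h.frame hf1 (by rcases ht with rfl | rfl <;> decide)
      (by rcases ht with rfl | rfl <;> decide)
    have f3 : ∀ s2 : State, Frame [12] [] s2 (s2.setReg 12 (j + 1)) := fun s2 =>
      Frame.setReg (by decide) _ _
    have hsame : ¬ (j ∈ R ∧ Q j) → joined Q R (j + 1) = joined Q R j := by
      intro hj
      ext a
      simp only [joined, mem_filter]
      refine and_congr_right fun haR => and_congr_right fun haQ => ?_
      have : a ≠ j := fun e => hj (e ▸ ⟨haR, haQ⟩)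
      omega
    have hjR : j ∈ R \ joined Q R j ↔ j ∈ R := by simp [joined]
    simp only [den.eq_5, den.eq_4, den.eq_1, eval_load, eval_reg]
    by_cases h7 : s1.arr 7 (s1.reg 12) = 0
    · rw [if_pos h7, hsame]
      · exact ⟨hF1.frame (f3 _) (by decide) (by decide), hE1.frame (f3 _) (by decide) (by decide)⟩
      · intro hc
        exact (hF1.root j hjn).2 (hjR.2 hc.1) (hj1 ▸ h7)
    · rw [if_neg h7]
      have hjR' : j ∈ R := hjR.1 ((hF1.root j hjn).1 (hj1 ▸ h7))
      have ft : Frame test.regs test.arrs s1 (test.den s1) := den_frame _ _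
      have h2 : Ready d k A (test.den s1) := h1.frame ft (by rcases ht with rfl | rfl <;> decide)
        (by rcases ht with rfl | rfl <;> decide)
      have hF2 : Forest d D (R \ joined Q R j) (test.den s1) := hF1.frame ft
        (by rcases ht with rfl | rfl <;> decide) (by rcases ht with rfl | rfl <;> decide)
      have hE2 : Current d T v m ((joined Q R j).biUnion D) (test.den s1) := hE1.frame ft
        (by rcases ht with rfl | rfl <;> decide) (by rcases ht with rfl | rfl <;> decide)
      have hj2 : (test.den s1).reg 12 = j :=
        (ft.1 12 (by rcases ht with rfl | rfl <;> decide)).trans hj1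
      have hQ' := hQ s1 h1 (hf1.1 4 (by rcases ht with rfl | rfl <;> decide)) (hj1 ▸ hjn)
      rw [hj1] at hQ'
      by_cases hq : Q j
      · rw [if_neg (hQ'.2 hq)]
        have hne : ∀ a ∈ joined Q R j, a ∈ R ∧ a ≠ j := fun a ha => by
          have := mem_filter.1 ha
          exact ⟨this.1, by omega⟩
        have hjoin : joined Q R (j + 1) = insert j (joined Q R j) := by
          ext a
          simp only [joined, mem_filter, mem_insert]
          constructor
          · rintro ⟨h1, h2, h3⟩
            by_cases e : a = j
            · exact Or.inl e
            · exact Or.inr ⟨h1, h2, by omega⟩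
          · rintro (rfl | ⟨h1, h2, h3⟩)
            · exact ⟨hjR', hq, by omega⟩
            · exact ⟨h1, h2, by omega⟩
        have hspec := joinCmd_spec hd h2 hF2 hE2 (by rw [hj2]; exact hjR.2 hjR')
          (biUnion_subset.2 fun a ha => hF.sub a (hne a ha).1)
          (by rw [hj2, disjoint_biUnion_left]
              exact fun a ha => (hF.disj a (hne a ha).1 j hjR' (hne a ha).2).1)
          (by rw [hj2]
              intro b hb
              obtain ⟨a, ha, hba⟩ := mem_biUnion.1 hb
              exact disjoint_of_subset_left (hF.sets a (hne a ha).1 b hba)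
                (hF.disj a (hne a ha).1 j hjR' (hne a ha).2).2)
        rw [hj2] at hspec
        rw [hjoin, biUnion_insert, union_comm, sdiff_insert]
        exact ⟨hspec.1.frame (f3 _) (by decide) (by decide),
          hspec.2.frame (f3 _) (by decide) (by decide)⟩
      · have : (test.den s1).reg 13 = 0 := not_not.1 (mt hQ'.1 hq)
        rw [if_pos this, hsame fun hc => hq hc.2]
        exact ⟨hF2.frame (f3 _) (by decide) (by decide),
          hE2.frame (f3 _) (by decide) (by decide)⟩)
  have hj : joined Q R d.n = R.filter Q := by
    ext a
    simp only [joined, mem_filter]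
    exact and_congr_right fun ha => ⟨fun h => h.1, fun h => ⟨h, mem_range.1 (hF.lt ha)⟩⟩
  rw [hj] at key
  rwa [filter_not]

/-- Sums over loops. -/
lemma sum_loop {x a : ℕ} {e f : Expr} {s : State} {b : ℕ} (F : ℕ → ℕ) (hxa : a ≠ x)
    (hb : e.eval s = b) (h0 : s.reg a = 0)
    (hf : ∀ i s', i < b → Frame [x, a] [] s s' → s'.reg x = i → f.eval s' = F i) :
    ((loop x e (assign a (reg a + f))).den s).reg a = ∑ i ∈ range b, F i := by
  refine Cmd.loop_inv (x := x) (fun i s' => s'.reg a = ∑ i ∈ range i, F i)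
    (by simpa [Cmd.regs] using hxa.symm) hb (by simp [hxa, h0]) ?_
  intro i s' hi hfr hx hI
  have := hf i s' hi hfr hx
  simp only [den.eq_2, State.setReg_reg, hxa, if_false, if_true, eval_add, eval_reg, this, hI,
    sum_range_succ]

/-- The register accumulates the inner product of two incidence rows, which is nonzero exactly when
they share an element. -/
lemma meetCmd_spec (h : Ready d k A s) (h4 : s.reg 4 < d.n) (h12 : s.reg 12 < d.n) :
    (meetCmd.den s).reg 13 ≠ 0 ↔ ¬ Disjoint (d.L (s.reg 4)) (d.L (s.reg 12)) := by
  have key := sum_loop (x := 3) (a := 13) (e := mE) (f := incE 4 * incE 12)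
    (s := s.setReg 13 0) (b := A 1) (fun e => inc A (s.reg 4) e * inc A (s.reg 12) e) (by decide)
    (by simp [h.hA]) (by simp) (by
      intro i s' hi hf hx
      have r4 : s'.reg 4 = s.reg 4 := by rw [hf.1 4 (by decide)]; simp
      have r12 : s'.reg 12 = s.reg 12 := by rw [hf.1 12 (by decide)]; simp
      have a0 : s'.arr 0 = A := by rw [hf.2 0 (by decide)]; simp [h.hA]
      simp [r4, r12, a0, hx])
  have hden : meetCmd.den s =
      (loop 3 mE (assign 13 (reg 13 + incE 4 * incE 12))).den (s.setReg 13 0) := rfl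
  rw [hden, key, h.hL _ h4, h.hL _ h12, Ne, sum_eq_zero_iff, not_disjoint_iff]
  simp only [mem_range, mem_filter, mul_eq_zero, not_forall, not_or]
  grind

/-- The current table is changed in place. This is safe because the remaining roots have tables with
numbers at most `T`, which is less than that of the current one. -/
lemma pointCmd_spec (hd : d.Bdd) {D : ℕ → Finset ℕ} {R E : Finset ℕ} {i T : ℕ}
    (h : Ready d k A s) (hi : s.reg 4 = i) (hF : Forest d D R s)
    (hE : Current d T (d.v i) (2 ^ i) E s) (hEn : insert i E ⊆ range d.n) (hiE : i ∉ E)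
    (hT : ∀ j ∈ R, s.arr 8 j ≤ T) (hL : ∀ a ∈ E, d.L a ⊆ d.L i) :
    Forest d D R (pointCmd.den s) ∧
    TableOK d ((pointCmd.den s).arr 4) ((pointCmd.den s).arr 5) (s.reg 11) (insert i E) := by
  have hin : i < d.n := mem_range.1 (hEn (mem_insert_self _ _))
  obtain ⟨t, ht⟩ : ∃ t, s.reg 11 = t + 1 := ⟨s.reg 11 - 1, by have := hE.lt; omega⟩
  have hTt : ∀ j ∈ R, s.arr 8 j ≤ t := fun j hj => (hT j hj).trans (by have := hE.lt; omega)
  set p := d.v i + d.val E with hp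
  -- Either the existing entry is already at least as good, or the item is infeasible: nothing is
  -- written.
  by_cases h0 : d.C - d.wt {i} - row d (s.arr 4) (t + 1) p = 0
  · have hden : pointCmd.den s = s := by
      simp only [row] at h0
      simp [pointCmd, h.hk, h.hA, h.hC, hi, h.hw i hin, h.addr_eq, hE.val, ← hp, ht, h0]
    rw [hden, ht]
    have htab := hE.table
    rw [ht] at htab
    exact ⟨hF, fun q hq hr => (htab.1 q hq hr).mono (subset_insert _ _),
      htab.2.insert hd hL hiE hEn (fun _ _ => le_rfl) fun _ => by rw [← hp]; omega⟩
  · have h1 : (pointCmd.den s).arr 4 =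
        Function.update (s.arr 4) ((t + 1) * (d.P + 1) + p) (d.C - d.wt {i}) := by
      simp only [row] at h0
      simp [pointCmd, h.hk, h.hA, h.hC, hi, h.hw i hin, h.addr_eq, hE.val, ← hp, ht, h0]
    have h2 : (pointCmd.den s).arr 5 =
        Function.update (s.arr 5) ((t + 1) * (d.P + 1) + p) (2 ^ i + KnapData.mask E) := by
      simp only [row] at h0
      simp [pointCmd, h.hk, h.hA, h.hC, hi, h.hw i hin, h.addr_eq, hE.val, ← hp, ht, h0, hE.mask]
    have h11 : (pointCmd.den s).reg 11 = s.reg 11 := den_reg _ _ (by decide)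
    have hent := KnapData.entry_insert hL hiE (by omega)
    have hpP : p ≤ d.P := hent.wt_lt (by omega) hd hEn
    have htab := hE.table
    rw [ht] at htab
    refine ⟨hF.step subset_rfl h11.ge ?_ (den_arr _ _ (by decide)) (den_arr _ _ (by decide))
      (den_arr _ _ (by decide)) hTt ?_ ?_, ?_⟩
    · rw [den_arr _ _ (by decide)]
      exact hF.root
    · rw [h1, h2]
      exact (Same.refl _ _ _).update
    · rw [h1, h2, h11, ht]
      have := hF.fresh
      rw [ht] at this
      exact this.update hpP
    · rw [h1, h2, ht]
      refine ⟨fun q hq => ?_, htab.2.insert hd hL hiE hEn (fun q hq => ?_) fun _ => ?_⟩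
      · rw [row_update, row_update]
        split_ifs with hc
        · subst hc
          exact fun _ => hent
        · exact fun hr => (htab.1 q hq hr).mono (subset_insert _ _)
      · rw [row_update]
        split_ifs with hc
        · subst hc; omega
        · exact le_rfl
      · rw [row_update, if_pos hp.symm]

lemma rootCmd_spec {D : ℕ → Finset ℕ} {R E : Finset ℕ} {i : ℕ}
    (hi : s.reg 4 = i) (hin : i < d.n) (hF : Forest d D R s) (hEn : E ⊆ range d.n)
    (hiR : i ∉ R) (htab : TableOK d (s.arr 4) (s.arr 5) (s.reg 11) E)
    (hval : s.reg 17 = d.val E) (hmask : s.reg 18 = KnapData.mask E)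
    (hsets : ∀ a ∈ E, d.L a ⊆ d.L i)
    (hdis : ∀ j ∈ R, Disjoint (D j) E ∧ Disjoint (d.L j) (d.L i)) :
    Forest d (Function.update D i E) (insert i R) (rootCmd.den s) := by
  have hne : ∀ j ∈ R, j ≠ i := fun j hj e => hiR (e ▸ hj)
  have a4 : (rootCmd.den s).arr 4 = s.arr 4 := den_arr _ _ (by decide)
  have a5 : (rootCmd.den s).arr 5 = s.arr 5 := den_arr _ _ (by decide)
  have r11 : (rootCmd.den s).reg 11 = s.reg 11 := den_reg _ _ (by decide)
  have a8 : (rootCmd.den s).arr 8 = Function.update (s.arr 8) i (s.reg 11) := by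
    simp [rootCmd, hi]
  have a7 : (rootCmd.den s).arr 7 = Function.update (s.arr 7) i 1 := by simp [rootCmd, hi]
  have a9 : (rootCmd.den s).arr 9 = Function.update (s.arr 9) i (d.val E) := by
    simp [rootCmd, hi, hval]
  have a10 : (rootCmd.den s).arr 10 = Function.update (s.arr 10) i (KnapData.mask E) := by
    simp [rootCmd, hi, hmask]
  refine ⟨insert_subset (mem_range.2 hin) hF.lt, ?_, ?_, ?_, ?_, ?_, ?_, ?_, ?_, ?_⟩
  · intro j hj
    rw [a7, Function.update_apply, mem_insert]
    split_ifs with hc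
    · simp [hc]
    · simpa [hc] using hF.root j hj
  · refine forall_mem_insert _ _ _ |>.2 ⟨by simpa using hEn, fun j hj => ?_⟩
    rw [Function.update_of_ne (hne j hj)]
    exact hF.sub j hj
  · rw [a8, r11]
    refine forall_mem_insert _ _ _ |>.2 ⟨by simp, fun j hj => ?_⟩
    rw [Function.update_of_ne (hne j hj)]
    exact hF.le j hj
  · rw [a8, a4, a5]
    refine forall_mem_insert _ _ _ |>.2 ⟨by simpa using htab, fun j hj => ?_⟩
    rw [Function.update_of_ne (hne j hj), Function.update_of_ne (hne j hj)]
    exact hF.table j hj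
  · rw [a9]
    refine forall_mem_insert _ _ _ |>.2 ⟨by simp, fun j hj => ?_⟩
    rw [Function.update_of_ne (hne j hj), Function.update_of_ne (hne j hj)]
    exact hF.val j hj
  · rw [a10]
    refine forall_mem_insert _ _ _ |>.2 ⟨by simp, fun j hj => ?_⟩
    rw [Function.update_of_ne (hne j hj), Function.update_of_ne (hne j hj)]
    exact hF.mask j hj
  · refine forall_mem_insert _ _ _ |>.2 ⟨by simpa using hsets, fun j hj => ?_⟩
    rw [Function.update_of_ne (hne j hj)]
    exact hF.sets j hj
  · intro j hj j' hj' hjj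
    rcases mem_insert.1 hj with rfl | hjR <;> rcases mem_insert.1 hj' with rfl | hjR'
    · exact absurd rfl hjj
    · rw [Function.update_self, Function.update_of_ne (hne j' hjR')]
      exact ⟨(hdis j' hjR').1.symm, (hdis j' hjR').2.symm⟩
    · rw [Function.update_self, Function.update_of_ne (hne j hjR)]
      exact hdis j hjR
    · rw [Function.update_of_ne (hne j' hjR'), Function.update_of_ne (hne j hjR)]
      exact hF.disj j hjR j' hjR' hjj
  · rw [a4, a5, r11]
    exact hF.fresh

/-! ### Building the forest -/

/-- Laminarity of the data. -/
def Lam (d : KnapData) : Prop :=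
  ∀ i < d.n, ∀ j < d.n, Disjoint (d.L i) (d.L j) ∨ d.L i ⊆ d.L j ∨ d.L j ⊆ d.L i

/-- The roots meeting the set of `i` are merged and become its subfamily; the others stay disjoint
from `i` and from everything below it. -/
lemma processCmd_spec (hd : d.Bdd) (hlam : Lam d) {D : ℕ → Finset ℕ} {R : Finset ℕ} {i : ℕ}
    (h : Ready d k A s) (hi : s.reg 4 = i) (hin : i < d.n) (hF : Forest d D R s)
    (hiR : i ∉ R) (hiD : i ∉ R.biUnion D) (hcard : ∀ j ∈ R, (d.L j).card ≤ (d.L i).card) :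
    ∃ D' R', Forest d D' R' (processCmd.den s) ∧ R' ⊆ insert i R ∧
      R'.biUnion D' = insert i (R.biUnion D) := by
  set s1 := newCmd.den s with hs1
  obtain ⟨hF1, h11, ht1⟩ := newCmd_spec h hF
  rw [← hs1] at hF1 h11 ht1
  have f1 : Frame newCmd.regs newCmd.arrs s s1 := den_frame _ _
  have h1 : Ready d k A s1 := h.frame f1 (by decide) (by decide)
  have hi1 : s1.reg 4 = i := (f1.1 4 (by decide)).trans hi
  have a8 : s1.arr 8 = s.arr 8 := f1.2 8 (by decide)
  set s2 := (assign 17 (load 11 (reg 4)) ;; assign 18 (load 6 (reg 4))).den s1 with hs2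
  have f2 : Frame [17, 18] [] s1 s2 :=
    den_frame (assign 17 (load 11 (reg 4)) ;; assign 18 (load 6 (reg 4))) s1
  have h2 : Ready d k A s2 := h1.frame f2 (by decide) (by decide)
  have hF2 : Forest d D R s2 := hF1.frame f2 (by decide) (by decide)
  have hi2 : s2.reg 4 = i := (f2.1 4 (by decide)).trans hi1
  have hE2 : Current d (s.reg 11) (d.v i) (2 ^ i) ∅ s2 := by
    refine ⟨?_, ?_, ?_, ?_⟩
    · rw [f2.1 11 (by decide)]; omega
    · rw [f2.1 11 (by decide), f2.2 4 (by decide), f2.2 5 (by decide)]; exact ht1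
    · simp [hs2, hi1, h1.hv i hin, KnapData.val]
    · simp [hs2, hi1, h1.h2 i hin, KnapData.mask]
  obtain ⟨hF3, hE3⟩ := mergeCmd_spec hd (Or.inl rfl) (fun j => ¬ Disjoint (d.L i) (d.L j))
    (fun s' hs' h4 h12 => by
      have h4' : s'.reg 4 = i := h4.trans hi2
      rw [← h4']
      exact meetCmd_spec hs' (h4' ▸ hin) h12) h2 hF2 hE2
  set E := (R.filter fun j => ¬ Disjoint (d.L i) (d.L j)).biUnion D with hE
  set s3 := (mergeCmd meetCmd).den s2 with hs3
  have f3 : Frame (mergeCmd meetCmd).regs (mergeCmd meetCmd).arrs s2 s3 := den_frame _ _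
  have h3 : Ready d k A s3 := h2.frame f3 (by decide) (by decide)
  have hi3 : s3.reg 4 = i := (f3.1 4 (by decide)).trans hi2
  have hER : E ⊆ R.biUnion D := biUnion_subset_biUnion_of_subset_left _ (filter_subset _ _)
  have hEn : insert i E ⊆ range d.n :=
    insert_subset (mem_range.2 hin) (hER.trans (biUnion_subset.2 hF.sub))
  have hiE : i ∉ E := fun hc => hiD (hER hc)
  have hLE : ∀ a ∈ E, d.L a ⊆ d.L i := by
    intro a ha
    obtain ⟨j, hj, haj⟩ := mem_biUnion.1 ha
    obtain ⟨hjR, hjd⟩ := mem_filter.1 hj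
    refine (hF.sets j hjR a haj).trans ?_
    -- If the set of `i` lies in that of `j`, the order of processing makes them equal, so ties are
    -- harmless.
    rcases hlam i hin j (mem_range.1 (hF.lt hjR)) with h | h | h
    · exact absurd h hjd
    · rw [eq_of_subset_of_card_le h (hcard j hjR)]
    · exact h
  -- The surviving roots use tables that existed before the processing of `i` began.
  have hT : ∀ j ∈ R.filter (fun j => ¬ ¬ Disjoint (d.L i) (d.L j)), s3.arr 8 j ≤ s.reg 11 := by
    intro j hj
    rw [f3.2 8 (by decide), f2.2 8 (by decide), a8]
    exact hF.le j (filter_subset _ _ hj)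
  obtain ⟨hF4, ht4⟩ := pointCmd_spec hd h3 hi3 hF3 hE3 hEn hiE hT hLE
  set s4 := pointCmd.den s3 with hs4
  have f4 : Frame pointCmd.regs pointCmd.arrs s3 s4 := den_frame _ _
  refine ⟨_, _, rootCmd_spec (s := s4) (i := i) (E := insert i E)
    ((f4.1 4 (by decide)).trans hi3) hin hF4 hEn
    (fun hc => hiR (filter_subset _ _ hc)) ?_ ?_ ?_ ?_ ?_, ?_, ?_⟩
  · rw [f4.1 11 (by decide)]; exact ht4
  · rw [f4.1 17 (by decide), hE3.val, KnapData.val_insert hiE]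
  · rw [f4.1 18 (by decide), hE3.mask, KnapData.mask_insert hiE]
  · exact forall_mem_insert _ _ _ |>.2 ⟨subset_rfl, hLE⟩
  · intro j hj
    obtain ⟨hjR, hjd⟩ := mem_filter.1 hj
    rw [not_not] at hjd
    refine ⟨disjoint_insert_right.2 ⟨fun hc => hiD (mem_biUnion.2 ⟨j, hjR, hc⟩), ?_⟩, hjd.symm⟩
    rw [hE, disjoint_biUnion_right]
    intro j' hj'
    obtain ⟨hjR', hjd'⟩ := mem_filter.1 hj'
    exact (hF.disj j hjR j' hjR' fun e => hjd' (e ▸ hjd)).1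
  · exact insert_subset_insert _ (filter_subset _ _)
  · rw [biUnion_insert, Function.update_self, insert_union]
    congr 1
    have : (R.filter fun j => ¬ ¬ Disjoint (d.L i) (d.L j)).biUnion
        (Function.update D i (insert i E)) =
        (R.filter fun j => ¬ ¬ Disjoint (d.L i) (d.L j)).biUnion D := by
      refine biUnion_congr rfl fun j hj => ?_
      rw [Function.update_of_ne]
      exact fun e => hiR (e ▸ filter_subset _ _ hj)
    rw [this, hE, ← union_biUnion, filter_union_filter_not_eq]

lemma forestCmd_spec (hd : d.Bdd) (hlam : Lam d) (h : Ready d k A s)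
    (h7 : ∀ j, s.arr 7 j = 0) (hF : Fresh d (s.arr 4) (s.arr 5) (s.reg 11)) :
    ∃ D R, Forest d D R (forestCmd.den s) ∧ R.biUnion D = range d.n := by
  -- The items already processed, in lexicographic order of cardinality and index.
  set B : ℕ → ℕ → Finset ℕ := fun c i =>
    (range d.n).filter fun x => (d.L x).card < c ∨ (d.L x).card = c ∧ x < i with hB
  have hBB : ∀ c, B c d.n = B (c + 1) 0 := by
    intro c
    ext x
    simp only [hB, mem_filter, mem_range]
    omega
  let I : ℕ → ℕ → State → Prop := fun c i s' =>
    ∃ D R, Forest d D R s' ∧ R ⊆ B c i ∧ R.biUnion D = B c i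
  have hI : ∀ c i s1 s2 X, Frame X [] s1 s2 → 11 ∉ X → I c i s1 → I c i s2 := by
    rintro c i s1 s2 X hf hX ⟨D, R, hF, h1, h2⟩
    exact ⟨D, R, hF.frame hf hX (by decide), h1, h2⟩
  have key := Cmd.loop_inv (x := 10) (e := mE + 1) (s := s) (c := loop 4 nE
      (ite (1 - ((load 3 (reg 4) - reg 10) + (reg 10 - load 3 (reg 4)))) processCmd skip))
    (fun c s' => I c 0 s') (by decide) (b := A 1 + 1) (by simp [h.hA]) (by
      refine ⟨fun _ => ∅, ∅, ⟨by simp, by simp [h7], by simp, by simp, by simp, by simp, by simp,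
        by simp, by simp, by simpa using hF⟩, by simp, ?_⟩
      simp [hB]) (by
    intro c s1 hc hf1 hc1 hI1
    have h1 : Ready d k A s1 := h.frame hf1 (by decide) (by decide)
    have key2 := Cmd.loop_inv (x := 4) (e := nE) (s := s1) (c :=
      ite (1 - ((load 3 (reg 4) - reg 10) + (reg 10 - load 3 (reg 4)))) processCmd skip)
      (fun i s' => I c i s') (by decide) (b := d.n) (by simp [h1.hA, h.hn])
      (hI _ _ _ _ [4] (Frame.setReg (by decide) _ _) (by decide) hI1) (by
      intro i s2 hi hf2 hi2 hI2
      have h2 : Ready d k A s2 := h1.frame hf2 (by decide) (by decide)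
      have r10 : s2.reg 10 = c := (hf2.1 10 (by decide)).trans hc1
      refine hI _ _ _ _ [4] (Frame.setReg (by decide) _ _) (by decide) ?_
      -- Equality test by truncated subtraction: the sum of the two differences is the distance.
      have hcond : 1 - ((d.L i).card - c + (c - (d.L i).card)) = 0 ↔ (d.L i).card ≠ c := by omega
      simp only [den.eq_5, eval_sub, eval_add, eval_load, eval_reg, eval_one, r10, hi2, h2.hc i hi,
        hcond, den.eq_1]
      have hcase : ∀ x, x < i + 1 ↔ x < i ∨ x = i := by omega
      by_cases hci : (d.L i).card = c
      · rw [if_neg (not_not.2 hci)]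
        obtain ⟨D, R, hF2, hRB, hRD⟩ := hI2
        have hiB : i ∉ B c i := by simp [hB, hci]
        obtain ⟨D', R', hF', hR', hD'⟩ := processCmd_spec hd hlam h2 hi2 hi hF2
          (fun hc => hiB (hRB hc)) (hRD ▸ hiB) (fun j hj => by
            have := (mem_filter.1 (hRB hj)).2
            omega)
        have hBi : B c (i + 1) = insert i (B c i) := by
          ext x
          simp only [hB, mem_filter, mem_insert, mem_range]
          constructor
          · rintro ⟨h1, h2⟩
            by_cases e : x = i
            · exact Or.inl e
            · exact Or.inr ⟨h1, by omega⟩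
          · rintro (rfl | ⟨h1, h2⟩)
            · exact ⟨hi, by omega⟩
            · exact ⟨h1, by omega⟩
        exact ⟨D', R', hF', hBi ▸ hR'.trans (insert_subset_insert _ hRB), by rw [hD', hBi, hRD]⟩
      · rw [if_pos hci]
        have hBi : B c (i + 1) = B c i := by
          ext x
          simp only [hB, mem_filter]
          refine and_congr_right fun _ => ?_
          by_cases e : x = i
          · subst e; omega
          · omega
        simpa only [I, hBi] using hI2)
    refine hI _ _ _ _ [10] (Frame.setReg (by decide) _ _) (by decide) ?_
    simpa only [I, hBB] using key2)
  obtain ⟨D, R, hF, -, hD⟩ := key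
  refine ⟨D, R, hF, hD.trans ?_⟩
  rw [hB]
  refine filter_true_of_mem fun x hx => Or.inl ?_
  rw [h.hL x (mem_range.1 hx)]
  exact Nat.lt_succ_of_le ((card_filter_le _ _).trans (card_range _).le)

/-! ### Reading off an optimal solution -/

lemma outputCmd_spec {E : Finset ℕ} (h : Ready d k A s)
    (htab : TableOK d (s.arr 4) (s.arr 5) (s.reg 11) E) (hC : 0 < d.C) :
    ∃ S ⊆ E, d.wt S < d.C ∧ (∀ T ⊆ E, d.wt T < d.C → d.val T ≤ d.val S) ∧
      ∀ i < d.n, (outputCmd.den s).arr 1 i ≠ 0 ↔ i ∈ S := by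
  set s1 := (assign 18 0).den s with hs1
  have f1 : Frame [18] [] s s1 := den_frame (assign 18 0) s
  have h1 : Ready d k A s1 := h.frame f1 (by decide) (by decide)
  set c2 := loop 14 pE
    (ite (load 4 (addr (reg 11) (reg 14))) (assign 18 (load 5 (addr (reg 11) (reg 14)))) skip)
    with hc2
  let r := row d (s.arr 4) (s.reg 11)
  have key := Cmd.loop_inv (x := 14) (e := pE) (s := s1) (c :=
    ite (load 4 (addr (reg 11) (reg 14))) (assign 18 (load 5 (addr (reg 11) (reg 14)))) skip)
    -- Register `18` holds the mask of the last nonzero entry below `p`, if there is one.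
    (fun p s' => (∀ q < p, r q = 0) ∨ ∃ q < p, r q ≠ 0 ∧ (∀ q' < p, q < q' → r q' = 0) ∧
      s'.reg 18 = row d (s.arr 5) (s.reg 11) q) (by decide) (b := d.P + 1)
    (by simp [h1.hk, h1.hA, h1.hP]) (Or.inl (by simp)) (by
    intro p s2 hp hf2 hp2 hI
    have h2 : Ready d k A s2 := h1.frame hf2 (by decide) (by decide)
    have a4 : s2.arr 4 = s.arr 4 := (hf2.2 4 (by decide)).trans (f1.2 4 (by decide))
    have a5 : s2.arr 5 = s.arr 5 := (hf2.2 5 (by decide)).trans (f1.2 5 (by decide))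
    have r11 : s2.reg 11 = s.reg 11 := (hf2.1 11 (by decide)).trans (f1.1 11 (by decide))
    have hr : (load 4 (addr (reg 11) (reg 14))).eval s2 = r p := by
      simp [h2.hk, h2.hA, h2.addr_eq, a4, r11, hp2, r, row]
    have hm : (load 5 (addr (reg 11) (reg 14))).eval s2 = row d (s.arr 5) (s.reg 11) p := by
      simp [h2.hk, h2.hA, h2.addr_eq, a5, r11, hp2, row]
    rw [den.eq_5, hr]
    by_cases h0 : r p = 0
    · rw [if_pos h0, den.eq_1]
      rcases hI with hI | ⟨q, hq, hrq, hqm, hI⟩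
      · refine Or.inl fun q hq => ?_
        by_cases e : q = p
        · exact e ▸ h0
        · exact hI q (by omega)
      · refine Or.inr ⟨q, by omega, hrq, fun q' hq' hqq => ?_, by simpa using hI⟩
        by_cases e : q' = p
        · exact e ▸ h0
        · exact hqm q' (by omega) hqq
    · rw [if_neg h0, den.eq_2, hm]
      exact Or.inr ⟨p, by omega, h0, fun q' hq' hqq => by omega, by simp⟩)
  rw [← hc2] at key
  -- The empty set is feasible since `0 < C`, so some entry is nonzero.
  have hne : ¬ ∀ q < d.P + 1, r q = 0 := by
    intro hc
    obtain ⟨p, hp, -, hp2⟩ := htab.2 ∅ (empty_subset _) (by simpa [KnapData.wt] using hC)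
    have : r p = 0 := hc p (by omega)
    simp only [KnapData.wt, biUnion_empty, sum_empty] at hp2
    change d.C ≤ r p + 0 at hp2
    omega
  obtain ⟨q, hq, hrq, hqm, h18⟩ := key.resolve_left hne
  obtain ⟨S, hS, hmS, hwS, hopt⟩ := KnapData.optimal htab.1 htab.2 (by omega : q ≤ d.P) hrq
    fun q' hq' hqq => hqm q' (by omega) hqq
  refine ⟨S, hS, hwS, hopt, ?_⟩
  set s2 := c2.den s1 with hs2
  have f2 : Frame c2.regs c2.arrs s1 s2 := den_frame _ _
  have h2 : Ready d k A s2 := h1.frame f2 (by decide) (by decide)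
  have key3 := Cmd.loop_inv (x := 4) (e := nE) (s := s2) (c :=
    assign 19 (reg 18 / load 6 (reg 4)) ;;
     store 1 (reg 4) (reg 19 - (reg 19 / 2 + reg 19 / 2)))
    (fun i s' => ∀ j < i, s'.arr 1 j ≠ 0 ↔ j ∈ S) (by decide) (b := d.n)
    (by simp [h2.hA, h2.hn]) (by simp) (by
    intro i s3 hi hf3 hi3 hI j hj
    have h3 : Ready d k A s3 := h2.frame hf3 (by decide) (by decide)
    have r18 : s3.reg 18 = KnapData.mask S := by
      rw [hf3.1 18 (by decide), h18, hmS]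
    simp only [den.eq_4, den.eq_3, den.eq_2, State.setReg_arr, State.setReg_reg, State.setArr_arr,
      eval_div, eval_sub, eval_add, eval_reg, eval_load, eval_two, if_true, hi3, r18,
      Function.update_apply, h3.h2 i hi]
    by_cases e : j = i
    · subst e
      have := KnapData.mask_bit S j
      rw [two_mul] at this
      simpa using this
    · simpa [e] using hI j (by omega))
  exact key3

/-! ### Scaling and rounding of the input -/

/-- Numerator of the value of an item. -/
def vn (A : ℕ → ℕ) (i : ℕ) : ℕ := A (4 + i)

/-- Denominator of the value of an item. -/
def vd (A : ℕ → ℕ) (i : ℕ) : ℕ := A (4 + A 0 + i)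

/-- Numerator of the weight of an element. -/
def wn (A : ℕ → ℕ) (e : ℕ) : ℕ := A (4 + (A 0 + A 0) + e)

/-- Denominator of the weight of an element. -/
def wd (A : ℕ → ℕ) (e : ℕ) : ℕ := A (4 + (A 0 + A 0) + A 1 + e)

/-- Common denominator of the weights and the capacity. -/
def cden (A : ℕ → ℕ) : ℕ := A 3 * ∏ e ∈ range (A 1), wd A e

/-- The integral data, with values rounded to multiples of `bn / (bd * k * n)`. -/
def mkData (k : ℕ) (A : ℕ → ℕ) (bn bd : ℕ) : KnapData where
  n := A 0
  P := k * (A 0 * A 0)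
  C := A 2 * (cden A / A 3) + 1
  L i := (range (A 1)).filter fun e => inc A i e ≠ 0
  w e := wn A e * (cden A / wd A e)
  v i := vn A i * (k * (A 0 * bd)) / (vd A i * bn)

/-- `bn / bd` is the largest value of the feasible items below `i`. -/
structure Best (k : ℕ) (A : ℕ → ℕ) (i bn bd : ℕ) : Prop where
  pos : 0 < bd
  mem : bn = 0 ∨ ∃ j < i, (mkData k A bn bd).wt {j} < (mkData k A bn bd).C ∧ bn = vn A j ∧
    bd = vd A j
  max : ∀ j < i, (mkData k A bn bd).wt {j} < (mkData k A bn bd).C → vn A j * bd ≤ vd A j * bn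

lemma Best.skip {i bn bd : ℕ} (h : Best k A i bn bd)
    (hi : (mkData k A bn bd).wt {i} < (mkData k A bn bd).C → vn A i * bd ≤ vd A i * bn) :
    Best k A (i + 1) bn bd where
  pos := h.pos
  mem := h.mem.imp_right fun ⟨j, hj, h⟩ => ⟨j, by omega, h⟩
  max := fun j hj => by
    rcases Nat.lt_succ_iff_lt_or_eq.1 hj with hj | rfl
    · exact h.max j hj
    · exact hi

lemma Best.update {i bn bd : ℕ} (h : Best k A i bn bd) (hvd : ∀ j ≤ i, 0 < vd A j)
    (hw : (mkData k A bn bd).wt {i} < (mkData k A bn bd).C)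
    (hlt : vd A i * bn < vn A i * bd) : Best k A (i + 1) (vn A i) (vd A i) where
  pos := hvd i le_rfl
  mem := Or.inr ⟨i, by omega, hw, rfl, rfl⟩
  max := fun j hj hwj => by
    rcases Nat.lt_succ_iff_lt_or_eq.1 hj with hj | rfl
    · have h1 := h.max j hj hwj
      refine Nat.le_of_mul_le_mul_right (c := bd) ?_ h.pos
      calc vn A j * vd A i * bd = vn A j * bd * vd A i := by ring
        _ ≤ vd A j * bn * vd A i := Nat.mul_le_mul_right _ h1
        _ = vd A j * (vd A i * bn) := by ring
        _ ≤ vd A j * (vn A i * bd) := Nat.mul_le_mul_left _ hlt.le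
        _ = vd A j * vn A i * bd := by ring
    · exact (mul_comm _ _).le

/-- The values of the feasible sets are bounded. -/
lemma Best.bdd {bn bd : ℕ} (h : Best k A (A 0) bn bd) : (mkData k A bn bd).Bdd := by
  intro S hS hw
  have h1 : ∀ i ∈ S, (mkData k A bn bd).v i ≤ k * A 0 := by
    intro i hi
    have h2 := h.max i (mem_range.1 (hS hi))
      ((KnapData.wt_mono (singleton_subset_iff.2 hi)).trans_lt hw)
    -- This covers `bn = 0` too, where division by zero makes the rounded value `0`.
    refine Nat.div_le_of_le_mul ?_
    calc vn A i * (k * (A 0 * bd)) = vn A i * bd * (k * A 0) := by ring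
      _ ≤ vd A i * bn * (k * A 0) := Nat.mul_le_mul_right _ h2
  have h3 : S.card ≤ A 0 := (card_le_card hS).trans (card_range _).le
  calc (mkData k A bn bd).val S ≤ S.card • (k * A 0) := sum_le_card_nsmul _ _ _ h1
    _ ≤ A 0 * (k * A 0) := Nat.mul_le_mul_right _ h3
    _ = k * (A 0 * A 0) := by ring

lemma denCmd_spec (hA : s.arr 0 = A) : (denCmd.den s).reg 1 = cden A ∧
    (denCmd.den s).reg 2 = A 2 * (cden A / A 3) + 1 := by
  set s1 := (assign 1 (load 0 3)).den s with hs1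
  have key := Cmd.loop_inv (x := 3) (e := mE) (s := s1) (c := assign 1 (reg 1 * wdE))
    (fun e s' => s'.reg 1 = A 3 * ∏ e ∈ range e, wd A e) (by decide) (b := A 1)
    (by simp [hs1, hA]) (by simp [hs1, hA]) (by
    intro i s' hi hf hi' hI
    have a0 : s'.arr 0 = A := (hf.2 0 (by decide)).trans (by simp [hs1, hA])
    simp [hI, a0, hi', prod_range_succ, wd, mul_assoc])
  have a0 : ((loop 3 mE (assign 1 (reg 1 * wdE))).den s1).arr 0 = A :=
    (den_arr _ _ (by decide)).trans (by simp [hs1, hA])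
  have hden : denCmd.den s = (assign 2 (load 0 2 * (reg 1 / load 0 3) + 1)).den
    ((loop 3 mE (assign 1 (reg 1 * wdE))).den s1) := rfl
  rw [hden, cden]
  generalize (loop 3 mE (assign 1 (reg 1 * wdE))).den s1 = s2 at *
  simp [key, a0]

lemma itemCmd_spec (hA : s.arr 0 = A) (h1 : s.reg 1 = cden A)
    (hinc : ∀ e < A 1, inc A (s.reg 4) e ≤ 1) (bn bd : ℕ) :
    (itemCmd.den s).reg 5 = (mkData k A bn bd).wt {s.reg 4} ∧
    (itemCmd.den s).reg 6 = ((mkData k A bn bd).L (s.reg 4)).card := by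
  set i := s.reg 4 with hi
  set s1 := (assign 5 0 ;; assign 6 0).den s with hs1
  have key := Cmd.loop_inv (x := 3) (e := mE) (s := s1) (c :=
    assign 5 (reg 5 + incE 4 * (wnE * (reg 1 / wdE))) ;; assign 6 (reg 6 + incE 4))
    (fun e s' => s'.reg 5 = ∑ e ∈ range e, inc A i e * (mkData k A bn bd).w e ∧
      s'.reg 6 = ∑ e ∈ range e, inc A i e) (by decide) (b := A 1)
    (by simp [hs1, hA]) (by simp [hs1]) (by
    rintro e s' he hf he' ⟨hI1, hI2⟩
    have a0 : s'.arr 0 = A := (hf.2 0 (by decide)).trans (by simp [hs1, hA])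
    have r1 : s'.reg 1 = cden A := (hf.1 1 (by decide)).trans (by simp [hs1, h1])
    have r4 : s'.reg 4 = i := (hf.1 4 (by decide)).trans (by simp [hs1, hi])
    simp [hI1, hI2, a0, r1, r4, he', sum_range_succ, mkData, wn, wd])
  have hden : itemCmd.den s = (loop 3 mE (assign 5 (reg 5 + incE 4 * (wnE * (reg 1 / wdE))) ;;
     assign 6 (reg 6 + incE 4))).den s1 := rfl
  rw [hden, key.1, key.2]
  -- The incidences are `0` or `1`, so multiplying by them selects the elements of the set.
  have h01 : ∀ e ∈ range (A 1), inc A i e = if inc A i e ≠ 0 then 1 else 0 := by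
    intro e he
    have := hinc e (mem_range.1 he)
    split_ifs <;> omega
  constructor
  · simp only [KnapData.wt, singleton_biUnion, mkData, sum_filter]
    refine sum_congr rfl fun e he => ?_
    have h := h01 e he
    split_ifs at h ⊢ <;> simp [h]
  · simp only [mkData, card_filter]
    exact sum_congr rfl h01

lemma prepCmd_spec (hA : s.arr 0 = A) (h1 : s.reg 1 = cden A)
    (h2 : s.reg 2 = A 2 * (cden A / A 3) + 1)
    (hinc : ∀ i < A 0, ∀ e < A 1, inc A i e ≤ 1) (hvd : ∀ i < A 0, 0 < vd A i) (k : ℕ) :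
    ∃ bn bd, (prepCmd.den s).reg 7 = bn ∧ (prepCmd.den s).reg 8 = bd ∧ Best k A (A 0) bn bd ∧
      (∀ i < A 0, (prepCmd.den s).arr 2 i = (mkData k A bn bd).wt {i}) ∧
      (∀ i < A 0, (prepCmd.den s).arr 3 i = ((mkData k A bn bd).L i).card) ∧
      ∀ i < A 0, (prepCmd.den s).arr 6 i = 2 ^ i := by
  set s1 := (assign 7 0 ;; assign 8 1 ;; assign 9 1).den s with hs1
  set c := itemCmd ;;
     store 2 (reg 4) (reg 5) ;;
     store 3 (reg 4) (reg 6) ;;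
     store 6 (reg 4) (reg 9) ;;
     assign 9 (reg 9 + reg 9) ;;
     ite (reg 2 - reg 5)
       (ite (vnE * reg 8 - vdE * reg 7) (assign 7 vnE ;; assign 8 vdE) skip)
       skip with hc
  have key := Cmd.loop_inv (x := 4) (e := nE) (s := s1) (c := c)
    -- Weights, sets and capacity do not involve `bn` and `bd`, so they are stated with `0 0` and
    -- agree by definition with those for the final best value.
    (fun i s' => s'.reg 9 = 2 ^ i ∧ Best k A i (s'.reg 7) (s'.reg 8) ∧
      (∀ j < i, s'.arr 2 j = (mkData k A 0 0).wt {j}) ∧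
      (∀ j < i, s'.arr 3 j = ((mkData k A 0 0).L j).card) ∧
      ∀ j < i, s'.arr 6 j = 2 ^ j) (by decide) (b := A 0)
    (by simp [hs1, hA]) (by
      simp only [hs1, den.eq_4, den.eq_2, State.setReg_reg, State.setReg_arr]
      exact ⟨by simp, ⟨by simp, by simp, by simp⟩, by simp, by simp, by simp⟩) (by
    rintro i s2 hi hf hi' ⟨hI9, hIb, hIw, hIc, hI2⟩
    have a0 : s2.arr 0 = A := (hf.2 0 (by decide)).trans (by simp [hs1, hA])
    have r1 : s2.reg 1 = cden A := (hf.1 1 (by decide)).trans (by simp [hs1, h1])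
    have r2 : s2.reg 2 = (mkData k A 0 0).C :=
      (hf.1 2 (by decide)).trans (by simp [hs1, h2, mkData])
    obtain ⟨k5, k6⟩ := itemCmd_spec (k := k) a0 r1 (by rw [hi']; exact hinc i hi) 0 0
    set s3 := itemCmd.den s2 with hs3
    have f3 : Frame itemCmd.regs itemCmd.arrs s2 s3 := den_frame _ _
    set s4 := (store 2 (reg 4) (reg 5) ;; store 3 (reg 4) (reg 6) ;; store 6 (reg 4) (reg 9) ;;
      assign 9 (reg 9 + reg 9)).den s3 with hs4
    set c5 := ite (reg 2 - reg 5)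
       (ite (vnE * reg 8 - vdE * reg 7) (assign 7 vnE ;; assign 8 vdE) skip) skip with hc5
    have hden : c.den s2 = c5.den s4 := rfl
    have r4 : s3.reg 4 = i := (f3.1 4 (by decide)).trans hi'
    rw [hi'] at k5 k6
    have f4 : Frame [9] [2, 3, 6] s3 s4 := den_frame (store 2 (reg 4) (reg 5) ;;
      store 3 (reg 4) (reg 6) ;; store 6 (reg 4) (reg 9) ;; assign 9 (reg 9 + reg 9)) s3
    have f5 : Frame [7, 8, 7, 8] [] s4 (c5.den s4) := (den_frame c5 s4).mono (by decide) (by decide)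
    have r7' : s4.reg 7 = s2.reg 7 := (f4.1 7 (by decide)).trans (f3.1 7 (by decide))
    have r8' : s4.reg 8 = s2.reg 8 := (f4.1 8 (by decide)).trans (f3.1 8 (by decide))
    have r4' : s4.reg 4 = i := (f4.1 4 (by decide)).trans r4
    have r2' : s4.reg 2 = (mkData k A 0 0).C :=
      (f4.1 2 (by decide)).trans ((f3.1 2 (by decide)).trans r2)
    have r5' : s4.reg 5 = (mkData k A 0 0).wt {i} := (f4.1 5 (by decide)).trans k5
    have a0' : s4.arr 0 = A := (f4.2 0 (by decide)).trans ((f3.2 0 (by decide)).trans a0)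
    have r9' : s4.reg 9 = 2 ^ (i + 1) := by
      simp [hs4, f3.1 9 (by decide), hI9]; ring
    have b2 : s4.arr 2 = Function.update (s2.arr 2) i ((mkData k A 0 0).wt {i}) := by
      simp [hs4, f3.2 2 (by decide), r4, k5]
    have b3 : s4.arr 3 = Function.update (s2.arr 3) i ((mkData k A 0 0).L i).card := by
      simp [hs4, f3.2 3 (by decide), r4, k6]
    have b6 : s4.arr 6 = Function.update (s2.arr 6) i (2 ^ i) := by
      simp [hs4, f3.2 6 (by decide), r4, f3.1 9 (by decide), hI9]
    have hupd : ∀ (f g : ℕ → ℕ), (∀ j < i, f j = g j) →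
        ∀ j < i + 1, Function.update f i (g i) j = g j := by
      intro f g h j hj
      rw [Function.update_apply]
      split_ifs with e
      · rw [e]
      · exact h j (by omega)
    have hbest : Best k A (i + 1) ((c5.den s4).reg 7) ((c5.den s4).reg 8) := by
      by_cases hw : (mkData k A 0 0).wt {i} < (mkData k A 0 0).C
      · have e1 : (reg 2 - reg 5).eval s4 ≠ 0 := by simp only [eval_sub, eval_reg]; omega
        by_cases hlt : vd A i * s2.reg 7 < vn A i * s2.reg 8
        · have e2 : (vnE * reg 8 - vdE * reg 7).eval s4 ≠ 0 := by
            simp only [eval_sub, eval_mul, eval_vnE, eval_vdE, eval_reg, r7', r8', a0', r4']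
            exact (Nat.sub_pos_of_lt hlt).ne'
          have h7 : (c5.den s4).reg 7 = vn A i := by
            rw [hc5, den.eq_5, if_neg e1, den.eq_5, if_neg e2]
            simp [a0', r4', vn]
          have h8 : (c5.den s4).reg 8 = vd A i := by
            rw [hc5, den.eq_5, if_neg e1, den.eq_5, if_neg e2]
            simp [a0', r4', vd]
          rw [h7, h8]
          exact hIb.update (fun j hj => hvd j (by omega)) hw hlt
        · have e2 : (vnE * reg 8 - vdE * reg 7).eval s4 = 0 := by
            simp only [eval_sub, eval_mul, eval_vnE, eval_vdE, eval_reg, r7', r8', a0', r4']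
            exact Nat.sub_eq_zero_of_le (not_lt.1 hlt)
          rw [hc5, den.eq_5, if_neg e1, den.eq_5, if_pos e2, den.eq_1, r7', r8']
          exact hIb.skip fun _ => not_lt.1 hlt
      · have e1 : (reg 2 - reg 5).eval s4 = 0 := by simp only [eval_sub, eval_reg]; omega
        rw [hc5, den.eq_5, if_pos e1, den.eq_1, r7', r8']
        exact hIb.skip fun h => absurd h hw
    simp only [hden, State.setReg_reg, State.setReg_arr]
    rw [if_neg (by decide), if_neg (by decide), if_neg (by decide), f5.1 9 (by decide),
      f5.2 2 (by decide), f5.2 3 (by decide), f5.2 6 (by decide), b2, b3, b6]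
    exact ⟨r9', hbest, hupd _ (fun i => (mkData k A 0 0).wt {i}) hIw,
      hupd _ (fun i => ((mkData k A 0 0).L i).card) hIc, hupd _ (fun i => 2 ^ i) hI2⟩)
  have hden : prepCmd.den s = (loop 4 nE c).den s1 := rfl
  rw [hden]
  exact ⟨_, _, rfl, rfl, key.2⟩

lemma scaleCmd_spec (h0 : s.reg 0 = k) (hA : s.arr 0 = A) :
    ∀ i < A 0, (scaleCmd.den s).arr 11 i = (mkData k A (s.reg 7) (s.reg 8)).v i := by
  refine Cmd.loop_inv (x := 4) (e := nE) (s := s)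
    (fun i s' => ∀ j < i, s'.arr 11 j = (mkData k A (s.reg 7) (s.reg 8)).v j)
    (by decide) (b := A 0) (by simp [hA]) (by simp) ?_
  intro i s' hi hf hi' hI j hj
  have a0 : s'.arr 0 = A := (hf.2 0 (by decide)).trans hA
  have r0 : s'.reg 0 = k := (hf.1 0 (by decide)).trans h0
  simp only [den.eq_3, State.setReg_arr, State.setArr_arr, if_true, Function.update_apply,
    eval_reg, hi']
  split_ifs with e
  · simp [a0, r0, hi', hf.1 7 (by decide), hf.1 8 (by decide), mkData, vn, vd, e]
  · exact hI j (by omega)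

/-- The program computes an optimal set of items for the rounded values. -/
theorem schemeCmd_spec {k : ℕ} {w : List ℕ} {A : ℕ → ℕ} (hA : A = fun i => w.getD i 0)
    (hinc : ∀ i < A 0, ∀ e < A 1, inc A i e ≤ 1) (hvd : ∀ i < A 0, 0 < vd A i)
    (hlam : Lam (mkData k A 0 0)) :
    ∃ bn bd, Best k A (A 0) bn bd ∧ ∃ S ⊆ range (A 0),
      (mkData k A bn bd).wt S < (mkData k A bn bd).C ∧
      (∀ T ⊆ range (A 0), (mkData k A bn bd).wt T < (mkData k A bn bd).C →
        (mkData k A bn bd).val T ≤ (mkData k A bn bd).val S) ∧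
      ∀ i < A 0, (schemeCmd.den (initState k w)).arr 1 i ≠ 0 ↔ i ∈ S := by
  set s := initState k w with hs
  have sA : s.arr 0 = A := by simp [hs, initState, hA]
  have s0 : s.reg 0 = k := by simp [hs, initState]
  set s1 := denCmd.den s with hs1
  obtain ⟨h1, h2⟩ := denCmd_spec sA
  rw [← hs1] at h1 h2
  have f1 : Frame denCmd.regs denCmd.arrs s s1 := den_frame _ _
  set s2 := prepCmd.den s1 with hs2
  have f2 : Frame prepCmd.regs prepCmd.arrs s1 s2 := den_frame _ _
  obtain ⟨bn, bd, h7, h8, hbest, hw, hc, hpow⟩ :=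
    prepCmd_spec ((f1.2 0 (by decide)).trans sA) h1 h2 hinc hvd k
  rw [← hs2] at h7 h8 hw hc hpow
  set s3 := scaleCmd.den s2 with hs3
  have f3 : Frame scaleCmd.regs scaleCmd.arrs s2 s3 := den_frame _ _
  have s2A : s2.arr 0 = A := (f2.2 0 (by decide)).trans ((f1.2 0 (by decide)).trans sA)
  have s20 : s2.reg 0 = k := (f2.1 0 (by decide)).trans ((f1.1 0 (by decide)).trans s0)
  have hv := scaleCmd_spec s20 s2A
  rw [h7, h8, ← hs3] at hv
  set d := mkData k A bn bd with hd
  have hR3 : Ready d k A s3 :=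
    { hk := (f3.1 0 (by decide)).trans s20
      hA := (f3.2 0 (by decide)).trans s2A
      hn := rfl
      hP := rfl
      hL := fun i _ => rfl
      hC := (f3.1 2 (by decide)).trans ((f2.1 2 (by decide)).trans h2)
      hw := by rw [f3.2 2 (by decide)]; exact hw
      hc := by rw [f3.2 3 (by decide)]; exact hc
      h2 := by rw [f3.2 6 (by decide)]; exact hpow
      hv := hv }
  have e11 : s3.reg 11 = 0 := by
    rw [f3.1 11 (by decide), f2.1 11 (by decide), f1.1 11 (by decide)]; simp [hs, initState]
  have earr : ∀ a, a = 4 ∨ a = 5 ∨ a = 7 → ∀ i, s3.arr a i = 0 := by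
    intro a ha i
    have : s3.arr a = s.arr a := by
      rcases ha with rfl | rfl | rfl <;>
      rw [f3.2 _ (by decide), f2.2 _ (by decide), f1.2 _ (by decide)]
    rw [this]
    have ha0 : a ≠ 0 := by omega
    simp [hs, initState, ha0]
  have hbdd : d.Bdd := hbest.bdd
  obtain ⟨D, R, hF4, hRD⟩ := forestCmd_spec hbdd hlam hR3 (earr 7 (by simp))
    (fun x _ => ⟨earr 4 (by simp) x, earr 5 (by simp) x⟩)
  set s4 := forestCmd.den s3 with hs4
  have f4 : Frame forestCmd.regs forestCmd.arrs s3 s4 := den_frame _ _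
  have hR4 : Ready d k A s4 := hR3.frame f4 (by decide) (by decide)
  obtain ⟨hF5, h115, ht5⟩ := newCmd_spec hR4 hF4
  set s5 := newCmd.den s4 with hs5
  have f5 : Frame newCmd.regs newCmd.arrs s4 s5 := den_frame _ _
  have hR5 : Ready d k A s5 := hR4.frame f5 (by decide) (by decide)
  -- All roots are merged. The accumulators in registers `17` and `18` no longer matter, so their
  -- present contents serve as `v` and `m`.
  obtain ⟨-, hE6⟩ := mergeCmd_spec hbdd (Or.inr rfl) (fun _ => True) (by simp) hR5 hF5
    ⟨(by omega : s4.reg 11 < s5.reg 11), ht5, (by simp [KnapData.val] : _ = s5.reg 17 + _),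
      (by simp [KnapData.mask] : _ = s5.reg 18 + _)⟩
  set s6 := (mergeCmd (assign 13 1)).den s5 with hs6
  have f6 : Frame (mergeCmd (assign 13 1)).regs (mergeCmd (assign 13 1)).arrs s5 s6 :=
    den_frame _ _
  have hR6 : Ready d k A s6 := hR5.frame f6 (by decide) (by decide)
  have htab := hE6.table
  rw [filter_true, hRD] at htab
  obtain ⟨S, hS, hwS, hopt, hout⟩ := outputCmd_spec hR6 htab (Nat.succ_pos _)
  exact ⟨bn, bd, hbest, S, hS, hwS, hopt, hout⟩

/-! ### The encoding of an instance -/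

lemma getD_append_ofFn {α : Type*} {l l' : List α} {n : ℕ} (f : Fin n → α) (a : α) {i : ℕ}
    (hi : i < n) : (l ++ List.ofFn f ++ l').getD (l.length + i) a = f ⟨i, hi⟩ := by
  rw [List.append_assoc, List.getD_append_right _ _ _ _ (by omega), Nat.add_sub_cancel_left,
    List.getD_append _ _ _ _ (by simpa using hi), List.getD_eq_getElem _ _ (by simpa using hi)]
  simp

/-- The input array of an instance. -/
def input (I : SUKP) (i : ℕ) : ℕ := I.encode.getD i 0

variable (I : SUKP)

@[simp] lemma input_zero : input I 0 = I.n := by simp [input, SUKP.encode]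
@[simp] lemma input_one : input I 1 = I.m := by simp [input, SUKP.encode]
@[simp] lemma input_two : input I 2 = I.K.num := by simp [input, SUKP.encode]
@[simp] lemma input_three : input I 3 = I.K.den := by simp [input, SUKP.encode]

lemma vn_input (i : Fin I.n) : vn (input I) i = (I.v i).num := by
  have := getD_append_ofFn (l := [I.n, I.m, I.K.num, I.K.den])
    (l' := List.ofFn (fun i => (I.v i).den) ++ (List.ofFn (fun j => (I.ω j).num) ++
      (List.ofFn (fun j => (I.ω j).den) ++
      List.ofFn (fun p : Fin (I.n * I.m) => if p.modNat ∈ I.L p.divNat then 1 else 0))))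
    (fun i => (I.v i).num) 0 i.2
  simp only [List.length_cons, List.length_nil] at this
  simpa only [vn, input, SUKP.encode, List.append_assoc] using this

lemma vd_input (i : Fin I.n) : vd (input I) i = (I.v i).den := by
  have := getD_append_ofFn (l := [I.n, I.m, I.K.num, I.K.den] ++ List.ofFn (fun i => (I.v i).num))
    (l' := List.ofFn (fun j => (I.ω j).num) ++
      (List.ofFn (fun j => (I.ω j).den) ++
      List.ofFn (fun p : Fin (I.n * I.m) => if p.modNat ∈ I.L p.divNat then 1 else 0)))
    (fun i => (I.v i).den) 0 i.2
  simp only [List.length_append, List.length_ofFn, List.length_cons, List.length_nil] at this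
  rw [vd, input_zero]
  simpa only [input, SUKP.encode, List.append_assoc] using this

lemma wn_input (j : Fin I.m) : wn (input I) j = (I.ω j).num := by
  have := getD_append_ofFn (l := [I.n, I.m, I.K.num, I.K.den] ++ List.ofFn (fun i => (I.v i).num)
      ++ List.ofFn (fun i => (I.v i).den))
    (l' := List.ofFn (fun j => (I.ω j).den) ++
      List.ofFn (fun p : Fin (I.n * I.m) => if p.modNat ∈ I.L p.divNat then 1 else 0))
    (fun j => (I.ω j).num) 0 j.2
  simp only [List.length_append, List.length_ofFn, List.length_cons, List.length_nil] at this
  rw [wn, input_zero, ← add_assoc]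
  simpa only [input, SUKP.encode, List.append_assoc] using this

lemma wd_input (j : Fin I.m) : wd (input I) j = (I.ω j).den := by
  have := getD_append_ofFn (l := [I.n, I.m, I.K.num, I.K.den] ++ List.ofFn (fun i => (I.v i).num)
      ++ List.ofFn (fun i => (I.v i).den) ++ List.ofFn (fun j => (I.ω j).num))
    (l' := List.ofFn (fun p : Fin (I.n * I.m) => if p.modNat ∈ I.L p.divNat then 1 else 0))
    (fun j => (I.ω j).den) 0 j.2
  simp only [List.length_append, List.length_ofFn, List.length_cons, List.length_nil] at this
  rw [wd, input_zero, input_one, ← add_assoc]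
  simpa only [input, SUKP.encode, List.append_assoc] using this

lemma inc_input (i : Fin I.n) (j : Fin I.m) :
    inc (input I) i j = if j ∈ I.L i then 1 else 0 := by
  have hlt : (i : ℕ) * I.m + j < I.n * I.m := by
    have := Nat.mul_le_mul_right I.m (Nat.succ_le_of_lt i.2)
    rw [Nat.succ_mul] at this
    omega
  have := getD_append_ofFn (l := [I.n, I.m, I.K.num, I.K.den] ++ List.ofFn (fun i => (I.v i).num)
      ++ List.ofFn (fun i => (I.v i).den) ++ List.ofFn (fun j => (I.ω j).num)
      ++ List.ofFn (fun j => (I.ω j).den)) (l' := [])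
    (fun p : Fin (I.n * I.m) => if p.modNat ∈ I.L p.divNat then 1 else 0) 0 hlt
  have hdiv : (⟨i * I.m + j, hlt⟩ : Fin (I.n * I.m)).divNat = i := by
    ext
    simp only [Fin.coe_divNat]
    rw [add_comm, Nat.add_mul_div_right _ _ j.pos, Nat.div_eq_of_lt j.2, zero_add]
  have hmod : (⟨i * I.m + j, hlt⟩ : Fin (I.n * I.m)).modNat = j := by
    ext
    simp only [Fin.coe_modNat]
    rw [add_comm, Nat.add_mul_mod_self_right, Nat.mod_eq_of_lt j.2]
  simp only [List.length_append, List.length_ofFn, List.length_cons, List.length_nil,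
    List.append_nil, hdiv, hmod] at this
  rw [inc, input_zero, input_one, show 4 + (I.n + I.n) + (I.m + I.m) + (i * I.m + j) =
    0 + 1 + 1 + 1 + 1 + I.n + I.n + I.m + I.m + (i * I.m + j) by ring]
  simpa only [input, SUKP.encode, List.append_assoc] using this

variable {I} (k bn bd : ℕ)

lemma L_input (i : Fin I.n) :
    (mkData k (input I) bn bd).L i = (I.L i).map Fin.valEmbedding := by
  ext e
  simp only [mkData, mem_filter, mem_range, input_one, mem_map, Fin.valEmbedding_apply]
  constructor
  · rintro ⟨he, h⟩
    refine ⟨⟨e, he⟩, ?_, rfl⟩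
    by_contra hc
    exact h (by simpa [hc] using inc_input I i ⟨e, he⟩)
  · rintro ⟨j, hj, rfl⟩
    exact ⟨j.2, by rw [inc_input]; simp [hj]⟩

lemma lam_input (h : I.Laminar) : Lam (mkData k (input I) bn bd) := by
  intro i hi j hj
  have hi' : i < I.n := by simpa [mkData] using hi
  have hj' : j < I.n := by simpa [mkData] using hj
  have h1 := L_input (I := I) k bn bd ⟨i, hi'⟩
  have h2 := L_input (I := I) k bn bd ⟨j, hj'⟩
  simp only at h1 h2
  rw [h1, h2, disjoint_map, map_subset_map, map_subset_map]
  rcases h ⟨i, hi'⟩ ⟨j, hj'⟩ with h | h | h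
  · exact Or.inl (disjoint_iff_inter_eq_empty.2 h)
  · exact Or.inr (Or.inl (inter_eq_left.1 h))
  · exact Or.inr (Or.inr (inter_eq_right.1 h))

lemma cden_ne_zero : cden (input I) ≠ 0 := by
  rw [cden, input_three, input_one]
  refine mul_ne_zero I.K.den_ne_zero (prod_ne_zero_iff.2 fun e he => ?_)
  rw [wd_input I ⟨e, mem_range.1 he⟩]
  exact NNRat.den_ne_zero _

lemma scale_eq {q : NNRat} {D : ℕ} (h : q.den ∣ D) :
    ((q.num * (D / q.den) : ℕ) : NNRat) = q * D := by
  have hq : (q.den : NNRat) ≠ 0 := by exact_mod_cast q.den_ne_zero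
  conv_rhs => rw [← NNRat.num_div_den q]
  rw [Nat.cast_mul, Nat.cast_div h hq]
  field_simp

lemma wt_input (T : Finset (Fin I.n)) :
    ((mkData k (input I) bn bd).wt (T.map Fin.valEmbedding) : NNRat) =
      (∑ j ∈ T.biUnion I.L, I.ω j) * cden (input I) := by
  have h : (T.map Fin.valEmbedding).biUnion (mkData k (input I) bn bd).L =
      (T.biUnion I.L).map Fin.valEmbedding := by
    ext e
    simp only [mem_biUnion, mem_map, Fin.valEmbedding_apply]
    constructor
    · rintro ⟨_, ⟨i, hi, rfl⟩, he⟩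
      rw [L_input] at he
      obtain ⟨j, hj, rfl⟩ := mem_map.1 he
      exact ⟨j, ⟨i, hi, hj⟩, rfl⟩
    · rintro ⟨j, ⟨i, hi, hj⟩, rfl⟩
      refine ⟨i, ⟨i, hi, rfl⟩, ?_⟩
      rw [L_input]
      exact mem_map_of_mem _ hj
  rw [KnapData.wt, h, sum_map, Nat.cast_sum, sum_mul]
  refine sum_congr rfl fun j _ => ?_
  have hdvd : (I.ω j).den ∣ cden (input I) := by
    rw [← wd_input]
    exact (dvd_prod_of_mem _ (mem_range.2 (by simp))).mul_left _
  rw [← scale_eq hdvd, ← wn_input, ← wd_input]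
  rfl

/-- Multiplying by the common denominator makes both sides integral, and the extra one in `C` turns
`≤` into `<`. -/
lemma feasible_iff (T : Finset (Fin I.n)) : I.Feasible T ↔
    (mkData k (input I) bn bd).wt (T.map Fin.valEmbedding) < (mkData k (input I) bn bd).C := by
  have hC : (mkData k (input I) bn bd).C =
      I.K.num * (cden (input I) / I.K.den) + 1 := by simp [mkData]
  have hdvd : I.K.den ∣ cden (input I) := by
    rw [← input_three]
    exact Dvd.intro _ rfl
  have hpos : (0 : NNRat) < cden (input I) := by
    exact_mod_cast Nat.pos_of_ne_zero cden_ne_zero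
  rw [hC, Nat.lt_succ_iff, ← Nat.cast_le (α := NNRat), wt_input, scale_eq hdvd,
    mul_le_mul_iff_left₀ hpos]
  rfl

lemma val_input (T : Finset (Fin I.n)) :
    (mkData k (input I) bn bd).val (T.map Fin.valEmbedding) =
      ∑ i ∈ T, (I.v i).num * (k * (I.n * bd)) / ((I.v i).den * bn) := by
  rw [KnapData.val, sum_map]
  refine sum_congr rfl fun i _ => ?_
  simp only [mkData, Fin.valEmbedding_apply, vn_input, vd_input, input_zero]

/-! ### Approximation -/

/-- Rounding down the values, relative to a feasible value `bn / bd`, loses a factor of at most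
`1 - ε`. -/
lemma approx {k bn bd : ℕ} {ε : ℝ} (hk : 1 ≤ k * ε) (hbest : Best k (input I) I.n bn bd)
    {S T : Finset (Fin I.n)} (hT : I.Feasible T)
    (hopt : ∀ T, I.Feasible T → (mkData k (input I) bn bd).val (T.map Fin.valEmbedding) ≤
      (mkData k (input I) bn bd).val (S.map Fin.valEmbedding)) :
    (1 - ε) * (I.value T : ℝ) ≤ (I.value S : ℝ) := by
  have hreal : ∀ U : Finset (Fin I.n),
      (I.value U : ℝ) = ∑ i ∈ U, ((I.v i).num / (I.v i).den : ℝ) := by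
    intro U
    rw [SUKP.value, NNRat.cast_sum]
    exact sum_congr rfl fun i _ => NNRat.cast_def _
  have hnonneg : ∀ U : Finset (Fin I.n), (0 : ℝ) ≤ I.value U := fun U => NNRat.cast_nonneg _
  have hbd : (0 : ℝ) < bd := by exact_mod_cast hbest.pos
  have hk0 : k ≠ 0 := by
    rintro rfl
    norm_num at hk
  have hkpos : (0 : ℝ) < k := by exact_mod_cast Nat.pos_of_ne_zero hk0
  have hε : 0 < ε := by
    by_contra! h
    nlinarith
  have hden : ∀ i, (0 : ℝ) < (I.v i).den := fun i => by
    exact_mod_cast Nat.pos_of_ne_zero (NNRat.den_ne_zero _)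
  -- Then every item that is feasible alone has value `0`, hence so has every feasible set.
  by_cases hbn : bn = 0
  · have : (I.value T : ℝ) = 0 := by
      rw [hreal]
      refine sum_eq_zero fun i hi => ?_
      have h1 := hbest.max i i.2 (lt_of_le_of_lt (KnapData.wt_mono
        (singleton_subset_iff.2 (mem_map_of_mem Fin.valEmbedding hi)))
        ((feasible_iff k bn bd T).1 hT))
      rw [vn_input, hbn, mul_zero] at h1
      have h2 : (I.v i).num = 0 := by
        rcases Nat.mul_eq_zero.1 (Nat.le_zero.1 h1) with h | h
        · exact h
        · exact absurd h hbest.pos.ne'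
      simp [h2]
    rw [this, mul_zero]
    exact hnonneg S
  obtain ⟨b, hb, hwb, hbn', hbd'⟩ := hbest.mem.resolve_left hbn
  have hn : 0 < I.n := by omega
  have hbnpos : (0 : ℝ) < bn := by exact_mod_cast Nat.pos_of_ne_zero hbn
  have hnpos : (0 : ℝ) < I.n := by exact_mod_cast hn
  -- The scaling factor: `fl i` is the floor of `c` times the value of `i`.
  set c : ℝ := k * I.n * bd / bn with hc
  have hcpos : 0 < c := by positivity
  set fl : Fin I.n → ℕ := fun i => (I.v i).num * (k * (I.n * bd)) / ((I.v i).den * bn) with hfl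
  have hquot : ∀ i, (((I.v i).num * (k * (I.n * bd)) : ℕ) : ℝ) / (((I.v i).den * bn : ℕ) : ℝ) =
      (I.v i).num / (I.v i).den * c := by
    intro i
    have := hden i
    push_cast
    rw [hc]
    field_simp
  have hle : ∀ i, (fl i : ℝ) ≤ (I.v i).num / (I.v i).den * c := by
    intro i
    rw [← hquot]
    exact Nat.cast_div_le
  have hlt : ∀ i, ((I.v i).num / (I.v i).den * c : ℝ) ≤ fl i + 1 := by
    intro i
    rw [← hquot, hfl]
    simp only
    rw [← Nat.floor_div_eq_div (K := ℝ)]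
    exact (Nat.lt_floor_add_one _).le
  have hS : ((∑ i ∈ S, fl i : ℕ) : ℝ) ≤ I.value S * c := by
    rw [hreal, sum_mul, Nat.cast_sum]
    exact sum_le_sum fun i _ => hle i
  have hT' : I.value T * c ≤ ((∑ i ∈ T, fl i : ℕ) : ℝ) + I.n := by
    have hcard : ((T.card : ℕ) : ℝ) ≤ I.n := by
      exact_mod_cast (card_le_univ T).trans (Fintype.card_fin _).le
    rw [hreal, sum_mul, Nat.cast_sum]
    calc ∑ i ∈ T, ((I.v i).num / (I.v i).den * c : ℝ) ≤ ∑ i ∈ T, ((fl i : ℝ) + 1) :=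
          sum_le_sum fun i _ => hlt i
      _ = ∑ i ∈ T, (fl i : ℝ) + T.card := by simp [sum_add_distrib]
      _ ≤ _ := by linarith
  have hST : ((∑ i ∈ T, fl i : ℕ) : ℝ) ≤ ((∑ i ∈ S, fl i : ℕ) : ℝ) := by
    have := hopt T hT
    rw [val_input, val_input] at this
    exact_mod_cast this
  -- Compare with the best single item, whose scaled value is exactly `k * n`.
  have hSb : (k * I.n : ℝ) ≤ ((∑ i ∈ S, fl i : ℕ) : ℝ) := by
    have hmap : ({⟨b, hb⟩} : Finset (Fin I.n)).map Fin.valEmbedding = {b} := by simp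
    have := hopt {⟨b, hb⟩} (by rw [feasible_iff k bn bd, hmap]; exact hwb)
    rw [val_input, val_input, sum_singleton] at this
    have h1 : (I.v ⟨b, hb⟩).num = bn := by rw [← vn_input, hbn']
    have h2 : (I.v ⟨b, hb⟩).den = bd := by rw [← vd_input, hbd']
    rw [h1, h2, show bn * (k * (I.n * bd)) = k * I.n * (bd * bn) by ring,
      Nat.mul_div_cancel _ (Nat.mul_pos hbest.pos (Nat.pos_of_ne_zero hbn))] at this
    exact_mod_cast this
  have hx : (I.value T : ℝ) * c ≤ I.value S * c + I.n := by linarith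
  have hy : (k * I.n : ℝ) ≤ I.value S * c := hSb.trans hS
  refine le_of_mul_le_mul_right ?_ hcpos
  have hTc : 0 ≤ (I.value T : ℝ) * c := mul_nonneg (hnonneg T) hcpos.le
  -- If `T` is the better set, the loss `n` is at most `ε * k * n`, which is at most `ε` times the
  -- scaled value of `T`.
  rcases le_total ((I.value T : ℝ) * c) (I.value S * c) with h | h
  · nlinarith
  · have h1 : (I.n : ℝ) ≤ ε * (I.value T * c) := by
      calc (I.n : ℝ) ≤ k * ε * I.n := le_mul_of_one_le_left hnpos.le hk
        _ = ε * (k * I.n) := by ring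
        _ ≤ ε * (I.value T * c) := mul_le_mul_of_nonneg_left (hy.trans h) hε.le
    linarith

/-! ### Loop bounds and the theorem -/

/-- The encoding has at least `n + m + 4` entries, so `n` and `m` are bounded by the word size
although they are written in binary. -/
lemma inputs_le (I : SUKP) (k : ℕ) :
    I.n ≤ (wordSize I.encode + 1) ^ 2 * (k + 1) ∧ I.m + 1 ≤ (wordSize I.encode + 1) ^ 2 * (k + 1) ∧
      k * (I.n * I.n) + 1 ≤ (wordSize I.encode + 1) ^ 2 * (k + 1) := by
  have h := length_le_wordSize I.encode
  have hl : I.n + I.m + 4 ≤ I.encode.length := by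
    simp only [SUKP.encode, List.length_append, List.length_ofFn, List.length_cons,
      List.length_nil]
    omega
  generalize wordSize I.encode = W at *
  have h1 : W + 1 ≤ (W + 1) ^ 2 * (k + 1) :=
    (Nat.le_self_pow two_ne_zero _).trans (Nat.le_mul_of_pos_right _ k.succ_pos)
  refine ⟨by omega, by omega, ?_⟩
  have h2 : I.n * I.n + 1 ≤ (W + 1) ^ 2 := by nlinarith
  nlinarith

end LaminarKnapsack

open LaminarKnapsack RAM in
theorem mainTheorem7 : laminarSUKP.AdmitsFPTAS := by
  obtain ⟨B, hB⟩ := Cmd.exec_poly schemeCmd schemeCmd_ok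
  refine ⟨schemeCmd.compile, B, fun ⟨I, hI⟩ ε hε => ?_⟩
  set k := ⌈1 / ε⌉₊ with hk
  -- The upper bound on `k` serves the running time, and the lower bound `1 ≤ k * ε` serves the
  -- accuracy.
  have hk1 : (k : ℝ) ≤ 1 / ε + 1 := (Nat.ceil_lt_add_one (by positivity)).le
  have hkε : 1 ≤ k * ε := by
    rw [← div_le_iff₀ hε]
    exact Nat.le_ceil _
  obtain ⟨hn, hm, hp⟩ := inputs_le I k
  have i0 : (initState k I.encode).arr 0 0 = I.n := input_zero I
  have i1 : (initState k I.encode).arr 0 1 = I.m := input_one I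
  obtain ⟨t, ht, hle⟩ := hB k I.encode
    (schemeCmd_loopsLE (by rwa [i0]) (by rwa [i1]) (by rw [i0]; exact hp))
  refine ⟨schemeCmd.den (initState k I.encode), t, ht, hle _ hk1, ?_⟩
  obtain ⟨bn, bd, hbest, S, hS, hwS, hopt, hout⟩ := schemeCmd_spec (k := k) (w := I.encode)
    (A := input I) rfl
    (fun i hi e he => by
      rw [input_zero] at hi
      rw [input_one] at he
      have := inc_input I ⟨i, hi⟩ ⟨e, he⟩
      simp only at this
      rw [this]
      split_ifs <;> simp)
    (fun i hi => by
      rw [input_zero] at hi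
      rw [vd_input I ⟨i, hi⟩]
      exact Nat.pos_of_ne_zero (NNRat.den_ne_zero _))
    (lam_input k 0 0 hI)
  rw [input_zero] at hbest hS hopt hout
  generalize schemeCmd.den (initState k I.encode) = s at hout ⊢
  set S' : Finset (Fin I.n) := univ.filter fun i : Fin I.n => s.arr 1 i ≠ 0 with hS'
  have hmap : S'.map Fin.valEmbedding = S := by
    ext i
    simp only [hS', mem_map, mem_filter, mem_univ, true_and, Fin.valEmbedding_apply]
    constructor
    · rintro ⟨j, hj, rfl⟩
      exact (hout j j.2).1 hj
    · intro hi
      have hin := mem_range.1 (hS hi)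
      exact ⟨⟨i, hin⟩, (hout i hin).2 hi, rfl⟩
  have hsub : ∀ T : Finset (Fin I.n), T.map Fin.valEmbedding ⊆ range I.n := by
    intro T i hi
    obtain ⟨j, -, rfl⟩ := mem_map.1 hi
    exact mem_range.2 j.2
  refine ⟨(feasible_iff k bn bd S').2 (by rwa [hmap]), fun T hT => ?_⟩
  refine approx (S := S') hkε hbest hT fun U hU => ?_
  rw [hmap]
  exact hopt _ (hsub U) ((feasible_iff k bn bd U).1 hU)
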